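/- Let $(g,\sigma)$ be a magnetic system on a smooth manifold $M$ (a smooth Riemannian metric $g$ and a smooth closed $2$-form $\sigma$), and let $N$ be a two-sided hypersurface of $M$, given by its inclusion (or, more generally, by a smooth immersion) $\iota\colon N\to M$ with $\dim M=\dim N+1$, equipped with the induced magnetic system $(\iota^*g,\iota^*\sigma)$ and with a smooth global unit normal field $\eta$ along $N$. Let $s>0$. Notation. For a magnetic system, $\mathcal Y$ denotes the Lorentz force, $g_x(\mathcal Y_x v,w)=\sigma_x(v,w)$; $\nabla$ is the Levi-Civita connection and $R(X,Y)Z=\nabla_X\nabla_YZ-\nabla_Y\nabla_XZ-\nabla_{[X,Y]}Z$ its curvature tensor. For a unit vector $v\in T_xM$, let $P_v$ and $P_{v^\perp}$ be the orthogonal projections onto $\mathbb Rv$ and $v^\perp$. The $s$-magnetic curvature operator on $v^\perp$ is $$\mathcal M_{(x,v)}(w)=s^2R_x(w,v)v-s(\nabla_w\mathcal Y)_x(v)+\tfrac s2P_{v^\perp}\big((\nabla_v\mathcal Y)_x(w)\big)-\tfrac34\mathcal Y_x\big(P_v(\mathcal Y_xw)\big)-\tfrac14P_{v^\perp}(\mathcal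 Y_x^2w),$$ and $\mathrm{sec}_x(v,w)=g_x(\mathcal M_{(x,v)}(w),w)$ for orthonormal $v,w$, $\mathrm{Ric}(x,v)=\mathrm{tr}\,\mathcal M_{(x,v)}$ for unit $v$. Superscripts $M$ and $N$ say which magnetic system is used. Further, $\top$ and $\perp$ are the tangential and normal parts along $N$, and for $x\in N$ and $v,w\in T_xN$, $$S_\eta(w)=-(\nabla^M_w\eta)^\top,\qquad S^\sigma_{(x,v)}(\eta_x)=s^2S_\eta(v)+s\,(\mathcal Y^M_x\eta_x)^\top,\qquad \theta_x(w)=g_x\big((\mathcal Y^M_xw)^\perp,\eta_x\big).$$ Then: (i) for all $x\in N$ and all orthonormal $v,w\in T_xN$, $$\mathrm{sec}^N_x(v,w)=\mathrm{sec}^M_x(v,w)+\begin{vmatrix} g_x(S^\sigma_{(x,v)}(\eta_x),v) & g_x(S_\eta(v),w)\\ g_x(S^\sigma_{(x,v)}(\eta_x),w) & g_x(S_\eta(w),w)\end{vmatrix}-\tfrac14\theta_x(w)^2;$$ (ii) for all $x\in N$ and all unit $v\in T_xN$, $$\mathrm{Ric}^N(x,v)=\mathrm{Ric}^M(x,v)-\mathrm{sec}^M_x(v,\eta_x)+\mathrm{tr}(S_\eta)\,g_x(S^\sigma_{(x,v)}(\eta_x),v)-g_x\big(S^\sigma_{(x,v)}(\eta_x),S_\eta(v)\big)-\tfrac14\big\|\theta_x|_{v^\perp}\big\|^2,$$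 where $\|\cdot\|$ is the norm of a linear functional on $v^\perp\subseteq T_xN$. -/

import Mathlib

open Bundle Manifold
open scoped ContDiff Manifold

noncomputable section

set_option maxSynthPendingDepth 3

namespace MagneticGeometry

/-! ## The Levi-Civita connection in a coordinate domain

`G y` is the component matrix of a metric at the point `y` of the coordinate space `E`, written as
a bilinear form. -/

section Coordinates

variable {E : Type*} [NormedAddCommGroup E] [NormedSpace ℝ E]

/-- Exchange of the last two arguments of a trilinear form. -/
def flipLast (T : E →L[ℝ] E →L[ℝ] E →L[ℝ] ℝ) : E →L[ℝ] E →L[ℝ] E →L[ℝ] ℝ :=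
  ((ContinuousLinearMap.flipₗᵢ ℝ E E ℝ).toContinuousLinearEquiv :
    (E →L[ℝ] E →L[ℝ] ℝ) →L[ℝ] E →L[ℝ] E →L[ℝ] ℝ) ∘L T

/-- The Christoffel symbols of the first kind,
`(u, v, z) ↦ (∂_u G(v, z) + ∂_v G(u, z) - ∂_z G(u, v)) / 2`. -/
def christoffelFirst (G : E → E →L[ℝ] E →L[ℝ] ℝ) (y : E) : E →L[ℝ] E →L[ℝ] E →L[ℝ] ℝ :=
  let D : E →L[ℝ] E →L[ℝ] E →L[ℝ] ℝ := fderiv ℝ G y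
  let D' : E →L[ℝ] E →L[ℝ] E →L[ℝ] ℝ := D.flip
  let D'' : E →L[ℝ] E →L[ℝ] E →L[ℝ] ℝ := flipLast D'
  (1 / 2 : ℝ) • (D + D' - D'')

/-- The Christoffel symbols (of the second kind): `Γ(u, v)` is the vector with
`G(Γ(u, v), z) = (∂_u G(v, z) + ∂_v G(u, z) - ∂_z G(u, v)) / 2` for all `z`. -/
def christoffel (G : E → E →L[ℝ] E →L[ℝ] ℝ) (y : E) : E →L[ℝ] E →L[ℝ] E :=
  (ContinuousLinearMap.compL ℝ E (E →L[ℝ] ℝ) E (G y).inverse) ∘L christoffelFirst G y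

/-- The curvature tensor `R(u, v) z = ∇_u ∇_v z - ∇_v ∇_u z` on constant (that is, coordinate)
vector fields `u`, `v`, `z`, where `∇_v z = Γ(v, z)`. -/
def coordCurvature (G : E → E →L[ℝ] E →L[ℝ] ℝ) (y u v z : E) : E :=
  (fderiv ℝ (christoffel G) y u v z + christoffel G y u (christoffel G y v z))
    - (fderiv ℝ (christoffel G) y v u z + christoffel G y v (christoffel G y u z))

/-- The covariant derivative of a field `A` of endomorphisms:
`(∇_u A)(v) = ∇_u (A v) - A (∇_u v)` for constant vector fields `u`, `v`. -/
def coordCovDerivEnd (G : E → E →L[ℝ] E →L[ℝ] ℝ) (A : E → E →L[ℝ] E) (y u v : E) : E :=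
  (fderiv ℝ A y u v + christoffel G y u (A y v)) - A y (christoffel G y u v)

lemma coordCurvature_add (G : E → E →L[ℝ] E →L[ℝ] ℝ) (y u u' v z : E) :
    coordCurvature G y (u + u') v z = coordCurvature G y u v z + coordCurvature G y u' v z := by
  unfold coordCurvature
  rw [map_add (fderiv ℝ (christoffel G) y) u u', map_add (christoffel G y) u u',
    add_apply, add_apply, add_apply, map_add (fderiv ℝ (christoffel G) y v) u u',
    add_apply, add_apply, map_add (christoffel G y v)]
  abel

lemma coordCurvature_smul (G : E → E →L[ℝ] E →L[ℝ] ℝ) (y : E) (c : ℝ) (u v z : E) :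
    coordCurvature G y (c • u) v z = c • coordCurvature G y u v z := by
  unfold coordCurvature
  rw [map_smul (fderiv ℝ (christoffel G) y) c u, map_smul (christoffel G y) c u,
    smul_apply, smul_apply, smul_apply, map_smul (fderiv ℝ (christoffel G) y v) c u,
    smul_apply, smul_apply, map_smul (christoffel G y v)]
  module

lemma coordCovDerivEnd_add_left (G : E → E →L[ℝ] E →L[ℝ] ℝ) (A : E → E →L[ℝ] E)
    (y u u' v : E) :
    coordCovDerivEnd G A y (u + u') v
      = coordCovDerivEnd G A y u v + coordCovDerivEnd G A y u' v := by
  unfold coordCovDerivEnd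
  rw [map_add (fderiv ℝ A y) u u', map_add (christoffel G y) u u', add_apply, add_apply,
    add_apply, map_add (A y)]
  abel

lemma coordCovDerivEnd_smul_left (G : E → E →L[ℝ] E →L[ℝ] ℝ) (A : E → E →L[ℝ] E)
    (y : E) (c : ℝ) (u v : E) :
    coordCovDerivEnd G A y (c • u) v = c • coordCovDerivEnd G A y u v := by
  unfold coordCovDerivEnd
  rw [map_smul (fderiv ℝ A y) c u, map_smul (christoffel G y) c u, smul_apply, smul_apply,
    smul_apply, map_smul (A y)]
  module

lemma coordCovDerivEnd_add_right (G : E → E →L[ℝ] E →L[ℝ] ℝ) (A : E → E →L[ℝ] E)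
    (y u v v' : E) :
    coordCovDerivEnd G A y u (v + v')
      = coordCovDerivEnd G A y u v + coordCovDerivEnd G A y u v' := by
  unfold coordCovDerivEnd
  rw [map_add (fderiv ℝ A y u), map_add (A y) v v', map_add (christoffel G y u) (A y v),
    map_add (christoffel G y u) v v', map_add (A y)]
  abel

lemma coordCovDerivEnd_smul_right (G : E → E →L[ℝ] E →L[ℝ] ℝ) (A : E → E →L[ℝ] E)
    (y : E) (c : ℝ) (u v : E) :
    coordCovDerivEnd G A y u (c • v) = c • coordCovDerivEnd G A y u v := by
  unfold coordCovDerivEnd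
  rw [map_smul (fderiv ℝ A y u), map_smul (A y) c v, map_smul (christoffel G y u) c (A y v),
    map_smul (christoffel G y u) c v, map_smul (A y)]
  module

end Coordinates

/-! ## Tensors on manifolds (without boundary) -/

section Manifold

variable {E : Type*} [NormedAddCommGroup E] [NormedSpace ℝ E]
  {H : Type*} [TopologicalSpace H] (I : ModelWithCorners ℝ E H)
  {M : Type*} [TopologicalSpace M] [ChartedSpace H M]

variable (M) in
/-- Fields of bilinear forms on the tangent spaces of `M`. -/
abbrev BilinField : Type _ :=
  ∀ x : M, TangentSpace I x →L[ℝ] TangentSpace I x →L[ℝ] ℝ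

/-- Fields of endomorphisms of the tangent spaces of `M`. -/
abbrev EndField (M : Type*) [TopologicalSpace M] [ChartedSpace H M] : Type _ :=
  ∀ x : M, TangentSpace I x →L[ℝ] TangentSpace I x

/-- A `2`-form `σ` is closed: `dσ(X, Y, Z) = 0` for all vector fields `X`, `Y`, `Z` that are smooth
at the point under consideration, with `dσ` expressed through Lie brackets. -/
def IsClosedTwoForm [IsManifold I ∞ M] (σ : BilinField I M) : Prop :=
  ∀ (x : M) (X Y Z : ∀ p : M, TangentSpace I p),
    ContMDiffAt I I.tangent ∞ (fun p => (⟨p, X p⟩ : TangentBundle I M)) x →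
    ContMDiffAt I I.tangent ∞ (fun p => (⟨p, Y p⟩ : TangentBundle I M)) x →
    ContMDiffAt I I.tangent ∞ (fun p => (⟨p, Z p⟩ : TangentBundle I M)) x →
    mvfderiv I (fun p => σ p (Y p) (Z p)) x (X x)
      + mvfderiv I (fun p => σ p (Z p) (X p)) x (Y x)
      + mvfderiv I (fun p => σ p (X p) (Y p)) x (Z x)
      - σ x (VectorField.mlieBracket I X Y x) (Z x)
      - σ x (VectorField.mlieBracket I Y Z x) (X x)
      - σ x (VectorField.mlieBracket I Z X x) (Y x) = 0

variable (M) in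
/-- A magnetic system on `M`: a smooth Riemannian metric and a smooth closed `2`-form. -/
structure MagneticSystem [IsManifold I ∞ M] where
  /-- the Riemannian metric -/
  metric : ContMDiffRiemannianMetric I ∞ E (fun x : M => TangentSpace I x)
  /-- the magnetic form -/
  form : BilinField I M
  form_self : ∀ (x : M) (v : TangentSpace I x), form x v v = 0
  form_contMDiff : ContMDiff I (I.prod 𝓘(ℝ, E →L[ℝ] E →L[ℝ] ℝ)) ∞
    (fun x : M => TotalSpace.mk' (E →L[ℝ] E →L[ℝ] ℝ)
      (E := fun x : M => TangentSpace I x →L[ℝ] TangentSpace I x →L[ℝ] ℝ) x (form x))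
  form_closed : IsClosedTwoForm I form

/-- The metric of a magnetic system, as a field of bilinear forms. -/
abbrev MagneticSystem.g {I : ModelWithCorners ℝ E H} [IsManifold I ∞ M] (S : MagneticSystem I M) :
    BilinField I M :=
  fun x => S.metric.inner x

variable {I}

/-- The differential at `x` of the chart around `x`: the components of a tangent vector. -/
def toCoord (x : M) : TangentSpace I x →L[ℝ] E :=
  mvfderiv I (extChartAt I x) x

/-- The tangent vector at the point with coordinates `y` in the chart around `x₀` whose components
in that chart are given. -/
def ofCoordAt (x₀ : M) (y : E) : E →L[ℝ] TangentSpace I ((extChartAt I x₀).symm y) :=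
  mfderiv 𝓘(ℝ, E) I (extChartAt I x₀).symm y

/-- The inverse of `toCoord x`. -/
def ofCoord (x : M) : E →L[ℝ] TangentSpace I x :=
  (toCoord x).inverse

/-- The components of a field of bilinear forms in the chart around `x₀`. -/
def coordForm (b : BilinField I M) (x₀ : M) (y : E) : E →L[ℝ] E →L[ℝ] ℝ :=
  ContinuousLinearMap.precomp ℝ (ofCoordAt x₀ y) ∘L b ((extChartAt I x₀).symm y) ∘L ofCoordAt x₀ y

/-- The Lorentz force operator `𝒴`, characterized by `g(𝒴 v, w) = σ(v, w)`. -/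
def lorentzForce (g σ : BilinField I M) : EndField I M :=
  fun x => (g x).inverse ∘L σ x

/-- The components of a field of endomorphisms in the chart around `x₀`. -/
def coordEnd (A : EndField I M) (x₀ : M) (y : E) : E →L[ℝ] E :=
  (ofCoordAt x₀ y).inverse ∘L A ((extChartAt I x₀).symm y) ∘L ofCoordAt x₀ y

/-- The curvature tensor `R(u, v) z = ∇_u ∇_v z - ∇_v ∇_u z - ∇_[u,v] z` of the Levi-Civita
connection of the metric `g`, computed in the chart around `x`. -/
def curvature (g : BilinField I M) (x : M) (u v z : TangentSpace I x) : TangentSpace I x :=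
  ofCoord x (coordCurvature (coordForm g x) (extChartAt I x x)
    (toCoord x u) (toCoord x v) (toCoord x z))

/-- The covariant derivative `(∇_u A)(v)` of a field of endomorphisms with respect to the
Levi-Civita connection of the metric `g`, computed in the chart around `x`. -/
def covDerivEnd (g : BilinField I M) (A : EndField I M) (x : M) (u v : TangentSpace I x) :
    TangentSpace I x :=
  ofCoord x (coordCovDerivEnd (coordForm g x) (coordEnd A x) (extChartAt I x x)
    (toCoord x u) (toCoord x v))

lemma curvature_add (g : BilinField I M) (x : M) (u u' v z : TangentSpace I x) :
    curvature g x (u + u') v z = curvature g x u v z + curvature g x u' v z := by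
  simp only [curvature, map_add, coordCurvature_add]

lemma curvature_smul (g : BilinField I M) (x : M) (c : ℝ) (u v z : TangentSpace I x) :
    curvature g x (c • u) v z = c • curvature g x u v z := by
  simp only [curvature, map_smul, coordCurvature_smul]

lemma covDerivEnd_add_left (g : BilinField I M) (A : EndField I M) (x : M)
    (u u' v : TangentSpace I x) :
    covDerivEnd g A x (u + u') v = covDerivEnd g A x u v + covDerivEnd g A x u' v := by
  simp only [covDerivEnd, map_add, coordCovDerivEnd_add_left]

lemma covDerivEnd_smul_left (g : BilinField I M) (A : EndField I M) (x : M) (c : ℝ)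
    (u v : TangentSpace I x) :
    covDerivEnd g A x (c • u) v = c • covDerivEnd g A x u v := by
  simp only [covDerivEnd, map_smul, coordCovDerivEnd_smul_left]

lemma covDerivEnd_add_right (g : BilinField I M) (A : EndField I M) (x : M)
    (u v v' : TangentSpace I x) :
    covDerivEnd g A x u (v + v') = covDerivEnd g A x u v + covDerivEnd g A x u v' := by
  simp only [covDerivEnd, map_add, coordCovDerivEnd_add_right]

lemma covDerivEnd_smul_right (g : BilinField I M) (A : EndField I M) (x : M) (c : ℝ)
    (u v : TangentSpace I x) :
    covDerivEnd g A x u (c • v) = c • covDerivEnd g A x u v := by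
  simp only [covDerivEnd, map_smul, coordCovDerivEnd_smul_right]

/-! ## Magnetic curvature -/

/-- The orthogonal projection onto the line spanned by the `g`-unit vector `v`. -/
def projLine (g : BilinField I M) (x : M) (v : TangentSpace I x) :
    TangentSpace I x →ₗ[ℝ] TangentSpace I x :=
  ((g x v : TangentSpace I x →L[ℝ] ℝ) : TangentSpace I x →ₗ[ℝ] ℝ).smulRight v

/-- The orthogonal projection onto `v^⊥`, for a `g`-unit vector `v`. -/
def projPerp (g : BilinField I M) (x : M) (v : TangentSpace I x) :
    TangentSpace I x →ₗ[ℝ] TangentSpace I x :=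
  LinearMap.id - projLine g x v

/-- The hyperplane `v^⊥ = {w | g(v, w) = 0}`. -/
def perp (g : BilinField I M) (x : M) (v : TangentSpace I x) : Submodule ℝ (TangentSpace I x) :=
  LinearMap.ker ((g x v : TangentSpace I x →L[ℝ] ℝ) : TangentSpace I x →ₗ[ℝ] ℝ)

/-- `A_{(x,v)}(w) = -3/4 𝒴(P_v(𝒴 w)) - 1/4 P_{v^⊥}(𝒴² w)`. -/
def magneticA (g σ : BilinField I M) (x : M) (v : TangentSpace I x) :
    TangentSpace I x →ₗ[ℝ] TangentSpace I x where
  toFun w := -(3 / 4 : ℝ) • lorentzForce g σ x (projLine g x v (lorentzForce g σ x w))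
    - (1 / 4 : ℝ) • projPerp g x v (lorentzForce g σ x (lorentzForce g σ x w))
  map_add' w w' := by simp only [map_add, smul_add]; abel
  map_smul' c w := by
    simp only [map_smul, RingHom.id_apply]
    module

/-- `R_{s,(x,v)}(w) = s² R(w, v) v - s (∇_w 𝒴)(v) + (s / 2) P_{v^⊥}((∇_v 𝒴)(w))`. -/
def magneticR (g σ : BilinField I M) (s : ℝ) (x : M) (v : TangentSpace I x) :
    TangentSpace I x →ₗ[ℝ] TangentSpace I x where
  toFun w := s ^ 2 • curvature g x w v v
    - s • covDerivEnd g (lorentzForce g σ) x w v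
    + (s / 2) • projPerp g x v (covDerivEnd g (lorentzForce g σ) x v w)
  map_add' w w' := by
    simp only [curvature_add, covDerivEnd_add_left, covDerivEnd_add_right, map_add]
    module
  map_smul' c w := by
    simp only [curvature_smul, covDerivEnd_smul_left, covDerivEnd_smul_right, map_smul,
      RingHom.id_apply]
    module

/-- The `s`-magnetic curvature operator at `(x, v)`, for a unit vector `v`. It is an operator on
`v^⊥`; the formula makes sense on the whole tangent space. -/
def magneticCurvature (g σ : BilinField I M) (s : ℝ) (x : M) (v : TangentSpace I x) :
    TangentSpace I x →ₗ[ℝ] TangentSpace I x :=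
  magneticR g σ s x v + magneticA g σ x v

/-- The `s`-magnetic sectional curvature of the orthonormal pair `(v, w)`. -/
def magneticSec (g σ : BilinField I M) (s : ℝ) (x : M) (v w : TangentSpace I x) : ℝ :=
  g x (magneticCurvature g σ s x v w) w

/-- The orthogonal projection of the tangent space onto `v^⊥`, as a map into `v^⊥`. -/
def projToPerp (g : BilinField I M) (x : M) (v : TangentSpace I x) (hv : g x v v = 1) :
    TangentSpace I x →ₗ[ℝ] perp g x v :=
  (projPerp g x v).codRestrict (perp g x v) (fun w => by
    simp [perp, projPerp, projLine, hv])

/-- The `s`-magnetic Ricci curvature of the unit vector `v`: the trace of the `s`-magnetic curvature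
operator on `v^⊥`. (The operator maps `v^⊥` to itself; the projection only records this in the
type of the codomain.) -/
def magneticRic (g σ : BilinField I M) (s : ℝ) (x : M) (v : TangentSpace I x)
    (hv : g x v v = 1) : ℝ :=
  LinearMap.trace ℝ (perp g x v)
    (projToPerp g x v hv ∘ₗ magneticCurvature g σ s x v ∘ₗ (perp g x v).subtype)

/-- The norm of the restriction to `v^⊥` of a linear functional on the tangent space. -/
def normOnPerp (g : BilinField I M) (x : M) (v : TangentSpace I x)
    (α : TangentSpace I x →ₗ[ℝ] ℝ) : ℝ :=
  sSup ((fun w => |α w|) '' {w : TangentSpace I x | w ∈ perp g x v ∧ g x w w ≤ 1})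

/-! ## Submanifolds

`ι : N → M` is the inclusion of a submanifold (or, more generally, an immersion). -/

variable {E' : Type*} [NormedAddCommGroup E'] [NormedSpace ℝ E']
  {H' : Type*} [TopologicalSpace H'] {J : ModelWithCorners ℝ E' H'}
  {N : Type*} [TopologicalSpace N] [ChartedSpace H' N]

/-- The pullback `ι^* b` of a field of bilinear forms. -/
def pullbackForm (J : ModelWithCorners ℝ E' H') (b : BilinField I M) (ι : N → M) :
    BilinField J N :=
  fun x => ContinuousLinearMap.precomp ℝ (mfderiv J I ι x) ∘L b (ι x) ∘L mfderiv J I ι x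

/-- The metric `ι^* g` of the magnetic system induced on the submanifold. -/
abbrev MagneticSystem.inducedMetric [IsManifold I ∞ M] (S : MagneticSystem I M)
    (J : ModelWithCorners ℝ E' H') (ι : N → M) : BilinField J N :=
  pullbackForm J S.g ι

/-- The magnetic form `ι^* σ` of the magnetic system induced on the submanifold. -/
abbrev MagneticSystem.inducedForm [IsManifold I ∞ M] (S : MagneticSystem I M)
    (J : ModelWithCorners ℝ E' H') (ι : N → M) : BilinField J N :=
  pullbackForm J S.form ι

/-- The tangential part `z^⊤ ∈ T_xN` of `z ∈ T_{ι x}M`, characterized by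
`(ι^* g)(z^⊤, w) = g(z, dι w)` for all `w ∈ T_xN`. -/
def tangentPart (J : ModelWithCorners ℝ E' H') (g : BilinField I M) (ι : N → M) (x : N)
    (z : TangentSpace I (ι x)) : TangentSpace J x :=
  (pullbackForm J g ι x).inverse ((g (ι x) z) ∘L mfderiv J I ι x)

/-- The normal part `z^⊥ = z - dι (z^⊤)` of `z ∈ T_{ι x}M`. -/
def normalPart (J : ModelWithCorners ℝ E' H') (g : BilinField I M) (ι : N → M) (x : N)
    (z : TangentSpace I (ι x)) : TangentSpace I (ι x) :=
  z - mfderiv J I ι x (tangentPart J g ι x z)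

/-- The components of a vector field `V` along `ι` in the chart of `M` around `ι x`. -/
def coordAlong (ι : N → M) (V : ∀ p : N, TangentSpace I (ι p)) (x : N) (p : N) : E :=
  mvfderiv I (extChartAt I (ι x)) (ι p) (V p)

/-- The covariant derivative `∇_w V` of a vector field `V` along `ι`, with respect to the
Levi-Civita connection of the metric `g` of `M`: in the chart of `M` around `ι x` it is
`dV(w) + Γ(dι w, V)`. -/
def covDerivAlong (g : BilinField I M) (ι : N → M) (V : ∀ p : N, TangentSpace I (ι p)) (x : N)
    (w : TangentSpace J x) : TangentSpace I (ι x) :=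
  ofCoord (ι x) (mvfderiv J (coordAlong ι V x) x w
    + christoffel (coordForm g (ι x)) (extChartAt I (ι x) (ι x))
        (toCoord (ι x) (mfderiv J I ι x w)) (toCoord (ι x) (V x)))

/-- The shape operator of a normal field `ξ`, given by the Weingarten formula
`S_ξ(w) = -(∇_w ξ)^⊤`. -/
def shapeOperator (g : BilinField I M) (ι : N → M) (ξ : ∀ p : N, TangentSpace I (ι p)) (x : N) :
    TangentSpace J x →ₗ[ℝ] TangentSpace J x where
  toFun w := -tangentPart J g ι x (covDerivAlong g ι ξ x w)
  map_add' w w' := by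
    simp only [tangentPart, covDerivAlong, map_add, add_apply,
      ContinuousLinearMap.add_comp]
    abel
  map_smul' c w := by
    simp only [tangentPart, covDerivAlong, map_add, map_smul, smul_apply,
      ContinuousLinearMap.smul_comp, ContinuousLinearMap.add_comp, RingHom.id_apply]
    module

/-- The `s`-magnetic shape operator `(S^σ_s)_{(x,v)}(ξ) = s² S_ξ(v) + s 𝒴(ξ)^⊤`, for a normal
field `ξ`. -/
def magneticShapeOperator (g σ : BilinField I M) (ι : N → M) (s : ℝ) (x : N)
    (v : TangentSpace J x) (ξ : ∀ p : N, TangentSpace I (ι p)) : TangentSpace J x :=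
  s ^ 2 • shapeOperator g ι ξ x v + s • tangentPart J g ι x (lorentzForce g σ (ι x) (ξ x))

/-- The normal Lorentz force `𝒴^⊥(w) = (𝒴(dι w))^⊥`. -/
def normalLorentzForce (g σ : BilinField I M) (ι : N → M) (x : N) (w : TangentSpace J x) :
    TangentSpace I (ι x) :=
  normalPart J g ι x (lorentzForce g σ (ι x) (mfderiv J I ι x w))

/-- The `1`-form `θ_x(w) = g(𝒴^⊥(w), η_x)` on `N`. -/
def thetaForm (g σ : BilinField I M) (ι : N → M) (η : ∀ p : N, TangentSpace I (ι p)) (x : N) :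
    TangentSpace J x →ₗ[ℝ] ℝ where
  toFun w := g (ι x) (normalLorentzForce g σ ι x w) (η x)
  map_add' w w' := by
    simp only [normalLorentzForce, normalPart, tangentPart, map_add, map_sub,
      add_apply, sub_apply, ContinuousLinearMap.add_comp]
    ring
  map_smul' c w := by
    simp only [normalLorentzForce, normalPart, tangentPart, map_smul, map_sub,
      smul_apply, sub_apply,
      ContinuousLinearMap.smul_comp, RingHom.id_apply, smul_eq_mul]
    ring

end Manifold

end MagneticGeometry

end

noncomputable section

open Filter Topology

set_option maxSynthPendingDepth 3

namespace MagneticGeometry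

/-! ## Metrics and immersions in coordinate domains -/

section Coordinates

variable {E : Type*} [NormedAddCommGroup E] [NormedSpace ℝ E]
  {E' : Type*} [NormedAddCommGroup E'] [NormedSpace ℝ E']

/-! The theorem compares the magnetic curvature operators of `N` and `M`, term by term, on tangent
vectors. Let b(u,z) = g(S_η u, z). Four comparisons suffice. (a) The curvature terms differ by the
classical Gauss equation, b(v,v)b(w,z) - b(w,v)b(v,z) (`IsHypersurface.curvature_eq`). (b) The
induced Lorentz force is the tangential part of the ambient one, and g(𝒴η, dι z) = -θ(z) because σ
is alternating. Differentiating g(𝒴 dι v, dι z) and inserting the Gauss formula, ∇𝒴 in direction w,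
applied to v and paired with z, changes by b(w,z)θ(v) - b(w,v)θ(z)
(`IsHypersurface.covDerivEnd_eq`). (c) From 𝒴 dι w = dι(𝒴^N w) + θ(w)η, the form of 𝒴² changes by
θ(w)θ(z) (`IsHypersurface.inducedMetric_lorentzForce_sq`). (d) The term with coefficient 3/4 pairs 𝒴
of tangent vectors with tangent vectors only, so it does not change. Their sum is the polarized
identity `IsHypersurface.inducedMetric_magneticCurvature`. For z = w orthogonal to v, the s/2
contribution cancels by antisymmetry and the rest is the determinant minus θ(w)²/4. For the Ricci
curvature the identity is read as one between operators on T_xN: its corrections are a multiple of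
S_η and rank-one operators, the s/2 part is again traceless, and the ambient trace contains one
extra normal term, sec^M(v,η).

The differential geometry behind (a) and (b) is done in charts. If F represents ι and Hess F(u,v) is
the covariant derivative of ∂_v F along u, then h(Γ(u,v), z) = G(Hess F(u,v), dF z) near the point.
Differentiating this identity once more, with metric compatibility on both sides, and
antisymmetrizing gives the Gauss equation. -/

/-- Near `y`, the matrix-valued function `G` is twice differentiable, symmetric and invertible. -/
structure IsMetricAt (G : E → E →L[ℝ] E →L[ℝ] ℝ) (y : E) : Prop where
  contDiffAt : ContDiffAt ℝ 2 G y
  symm : ∀ᶠ y' in 𝓝 y, ∀ a b, G y' a b = G y' b a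
  isInvertible : (G y).IsInvertible

lemma IsMetricAt.differentiableAt {G : E → E →L[ℝ] E →L[ℝ] ℝ} {y : E} (hG : IsMetricAt G y) :
    DifferentiableAt ℝ G y :=
  hG.contDiffAt.differentiableAt (by norm_num)

/-- Invertibility is an open condition. Having the property on a neighbourhood is what allows
identities proved at a point to be differentiated. -/
lemma IsMetricAt.eventually [CompleteSpace E] {G : E → E →L[ℝ] E →L[ℝ] ℝ} {y : E}
    (hG : IsMetricAt G y) : ∀ᶠ y' in 𝓝 y, IsMetricAt G y' := by
  obtain ⟨e, he⟩ := hG.isInvertible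
  have hinv : ∀ᶠ y' in 𝓝 y, (G y').IsInvertible := by
    have := hG.contDiffAt.continuousAt.eventually
      (by rw [← he]; exact e.nhds : Set.range ((↑) : (E ≃L[ℝ] E →L[ℝ] ℝ) → _) ∈ 𝓝 (G y))
    exact this
  filter_upwards [hG.contDiffAt.eventually (by norm_num), hG.symm.eventually_nhds, hinv]
    with y' h₁ h₂ h₃ using ⟨h₁, h₂, h₃⟩

lemma christoffelFirst_apply (G : E → E →L[ℝ] E →L[ℝ] ℝ) (y u v z : E) :
    christoffelFirst G y u v z
      = 1 / 2 * (fderiv ℝ G y u v z + fderiv ℝ G y v u z - fderiv ℝ G y z u v) := by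
  simp [christoffelFirst, flipLast]

lemma IsMetricAt.apply_christoffel {G : E → E →L[ℝ] E →L[ℝ] ℝ} {y : E}
    (hG : IsMetricAt G y) (u v z : E) :
    G y (christoffel G y u v) z
      = 1 / 2 * (fderiv ℝ G y u v z + fderiv ℝ G y v u z - fderiv ℝ G y z u v) := by
  rw [← christoffelFirst_apply]
  simp [christoffel, hG.isInvertible.self_apply_inverse]

lemma fderiv_bilin_apply {G : E → E →L[ℝ] E →L[ℝ] ℝ} {F P Q : E' → E} {y : E'}
    (hG : DifferentiableAt ℝ G (F y)) (hF : DifferentiableAt ℝ F y)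
    (hP : DifferentiableAt ℝ P y) (hQ : DifferentiableAt ℝ Q y) (u : E') :
    fderiv ℝ (fun p => G (F p) (P p) (Q p)) y u
      = fderiv ℝ G (F y) (fderiv ℝ F y u) (P y) (Q y) + G (F y) (fderiv ℝ P y u) (Q y)
        + G (F y) (P y) (fderiv ℝ Q y u) := by
  have hGF : HasFDerivAt (fun p => G (F p)) ((fderiv ℝ G (F y)).comp (fderiv ℝ F y)) y :=
    hG.hasFDerivAt.comp y hF.hasFDerivAt
  rw [((hGF.clm_apply hP.hasFDerivAt).clm_apply hQ.hasFDerivAt).fderiv]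
  simp
  ring

lemma IsMetricAt.fderiv_apply_const {G : E → E →L[ℝ] E →L[ℝ] ℝ} {y : E} (hG : IsMetricAt G y)
    (u a b : E) : fderiv ℝ (fun p => G p a b) y u = fderiv ℝ G y u a b := by
  have := fderiv_bilin_apply (F := id) (P := fun _ => a) (Q := fun _ => b)
    hG.differentiableAt differentiableAt_id (differentiableAt_const _)
    (differentiableAt_const _) u
  simpa using this

lemma IsMetricAt.fderiv_symm {G : E → E →L[ℝ] E →L[ℝ] ℝ} {y : E} (hG : IsMetricAt G y)
    (u a b : E) : fderiv ℝ G y u a b = fderiv ℝ G y u b a := by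
  rw [← hG.fderiv_apply_const u a b, ← hG.fderiv_apply_const u b a]
  have : (fun p => G p a b) =ᶠ[𝓝 y] (fun p => G p b a) := by
    filter_upwards [hG.symm] with p hp using hp a b
  rw [this.fderiv_eq]

lemma IsMetricAt.symm_apply {G : E → E →L[ℝ] E →L[ℝ] ℝ} {y : E} (hG : IsMetricAt G y)
    (a b : E) : G y a b = G y b a :=
  hG.symm.self_of_nhds a b

/-- The connection is torsion-free: the Koszul expression is symmetric in its first two arguments,
and G is nondegenerate. -/
lemma IsMetricAt.christoffel_symm {G : E → E →L[ℝ] E →L[ℝ] ℝ} {y : E} (hG : IsMetricAt G y)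
    (u v : E) : christoffel G y u v = christoffel G y v u := by
  apply hG.isInvertible.injective
  ext z
  rw [hG.apply_christoffel, hG.apply_christoffel, hG.fderiv_symm z u v]
  ring

/-- Metric compatibility: in the sum of two Koszul expressions all terms cancel except two equal
ones. -/
lemma IsMetricAt.fderiv_eq {G : E → E →L[ℝ] E →L[ℝ] ℝ} {y : E} (hG : IsMetricAt G y)
    (u a b : E) :
    fderiv ℝ G y u a b = G y (christoffel G y u a) b + G y a (christoffel G y u b) := by
  rw [hG.symm_apply a, hG.apply_christoffel, hG.apply_christoffel, hG.fderiv_symm u b a,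
    hG.fderiv_symm a u b, hG.fderiv_symm b u a]
  ring

lemma IsMetricAt.contDiffAt_christoffel [CompleteSpace E] {G : E → E →L[ℝ] E →L[ℝ] ℝ} {y : E}
    (hG : IsMetricAt G y) : ContDiffAt ℝ 1 (christoffel G) y := by
  have h₁ : ContDiffAt ℝ 1 (fderiv ℝ G) y := hG.contDiffAt.fderiv_right (by norm_num)
  have h₂ : ContDiffAt ℝ 1 (fun p => (G p).inverse) y :=
    (hG.isInvertible.contDiffAt_map_inverse).comp y (hG.contDiffAt.of_le (by norm_num))
  have h₃ : ContDiffAt ℝ 1 (christoffelFirst G) y := by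
    have hflip : ContDiffAt ℝ 1 (fun p => (fderiv ℝ G p).flip) y :=
      (ContinuousLinearMap.flipₗᵢ ℝ E E (E →L[ℝ] ℝ)).contDiff.contDiffAt.comp y h₁
    exact ((h₁.add hflip).sub (contDiffAt_const.clm_comp hflip)).const_smul (1 / 2 : ℝ)
  exact ((ContinuousLinearMap.compL ℝ E (E →L[ℝ] ℝ) E).contDiff.contDiffAt.comp y h₂).clm_comp h₃

/-- The covariant derivative of the vector field `P` along the map `F`. -/
def coordCovAlong (G : E → E →L[ℝ] E →L[ℝ] ℝ) (F P : E' → E) (y u : E') : E :=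
  fderiv ℝ P y u + christoffel G (F y) (fderiv ℝ F y u) (P y)

/-- Metric compatibility for fields along a map. Every derivative of an inner product below is an
instance of this rule. -/
lemma IsMetricAt.fderiv_along {G : E → E →L[ℝ] E →L[ℝ] ℝ} {F P Q : E' → E} {y : E'}
    (hG : IsMetricAt G (F y)) (hF : DifferentiableAt ℝ F y)
    (hP : DifferentiableAt ℝ P y) (hQ : DifferentiableAt ℝ Q y) (u : E') :
    fderiv ℝ (fun p => G (F p) (P p) (Q p)) y u
      = G (F y) (coordCovAlong G F P y u) (Q y) + G (F y) (P y) (coordCovAlong G F Q y u) := by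
  rw [fderiv_bilin_apply hG.differentiableAt hF hP hQ, hG.fderiv_eq]
  simp only [coordCovAlong, map_add, add_apply]
  ring

/-- The second fundamental form of `F` before projection to the normal space: the covariant
derivative in the direction `u` of the field `∂_v F`. -/
def coordHess (G : E → E →L[ℝ] E →L[ℝ] ℝ) (F : E' → E) (y u v : E') : E :=
  coordCovAlong G F (fun p => fderiv ℝ F p v) y u

lemma differentiableAt_fderiv_apply {F : E' → E} {y : E'} {n : WithTop ℕ∞}
    (hF : ContDiffAt ℝ n F y) (hn : 2 ≤ n) (v : E') :
    DifferentiableAt ℝ (fun p => fderiv ℝ F p v) y :=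
  ((hF.fderiv_right (m := 1) (by simpa using! hn)).differentiableAt (by norm_num)).clm_apply
    (differentiableAt_const v)

lemma fderiv_fderiv_apply_comm {F : E' → E} {y : E'} {n : WithTop ℕ∞}
    (hF : ContDiffAt ℝ n F y) (hn : 2 ≤ n) (u v : E') :
    fderiv ℝ (fun p => fderiv ℝ F p v) y u = fderiv ℝ (fun p => fderiv ℝ F p u) y v := by
  have hd : DifferentiableAt ℝ (fderiv ℝ F) y :=
    (hF.fderiv_right (m := 1) (by simpa using! hn)).differentiableAt (by norm_num)
  have key : ∀ u v : E', fderiv ℝ (fun p => fderiv ℝ F p v) y u = fderiv ℝ (fderiv ℝ F) y u v := by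
    intro u v
    rw [fderiv_clm_apply hd (differentiableAt_const v)]
    simp
  rw [key, key]
  exact (hF.isSymmSndFDerivAt (by simpa using! hn)).eq u v

/-- Symmetry of second derivatives together with vanishing torsion. -/
lemma coordHess_comm {G : E → E →L[ℝ] E →L[ℝ] ℝ} {F : E' → E} {y : E'}
    (hG : IsMetricAt G (F y)) (hF : ContDiffAt ℝ 2 F y) (u v : E') :
    coordHess G F y u v = coordHess G F y v u := by
  simp only [coordHess, coordCovAlong]
  rw [fderiv_fderiv_apply_comm hF le_rfl, hG.christoffel_symm]

/-- The case F = id of the product rule, with one constant field: it differentiates the intrinsic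
side of the identities along F. -/
lemma IsMetricAt.fderiv_field {h : E' → E' →L[ℝ] E' →L[ℝ] ℝ} {P : E' → E'} {y : E'}
    (hh : IsMetricAt h y) (hP : DifferentiableAt ℝ P y) (u z : E') :
    fderiv ℝ (fun p => h p (P p) z) y u
      = h y (fderiv ℝ P y u + christoffel h y u (P y)) z + h y (P y) (christoffel h y u z) := by
  have := IsMetricAt.fderiv_along (G := h) (F := id) (Q := fun _ => z) hh differentiableAt_id hP
    (differentiableAt_const _) u
  simpa [coordCovAlong] using this

/-- `h` is the pullback of `G` under `F` near `y`. -/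
structure IsPullbackAt (G : E → E →L[ℝ] E →L[ℝ] ℝ) (F : E' → E)
    (h : E' → E' →L[ℝ] E' →L[ℝ] ℝ) (y : E') : Prop where
  metric : IsMetricAt G (F y)
  contDiffAt : ContDiffAt ℝ 3 F y
  pullback : IsMetricAt h y
  eq : ∀ᶠ p in 𝓝 y, ∀ a b, h p a b = G (F p) (fderiv ℝ F p a) (fderiv ℝ F p b)

/-! ### Pullback metrics and the Gauss and Weingarten equations in coordinates. -/

section Pullback

variable {G : E → E →L[ℝ] E →L[ℝ] ℝ} {F : E' → E} {h : E' → E' →L[ℝ] E' →L[ℝ] ℝ} {y : E'}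

lemma IsPullbackAt.eventually [CompleteSpace E] [CompleteSpace E'] (H : IsPullbackAt G F h y) :
    ∀ᶠ p in 𝓝 y, IsPullbackAt G F h p := by
  filter_upwards [H.contDiffAt.continuousAt.eventually H.metric.eventually,
    H.contDiffAt.eventually (by norm_num), H.pullback.eventually, H.eq.eventually_nhds]
    with p h₁ h₂ h₃ h₄ using ⟨h₁, h₂, h₃, h₄⟩

lemma IsPullbackAt.contDiffAt_two (H : IsPullbackAt G F h y) : ContDiffAt ℝ 2 F y :=
  H.contDiffAt.of_le (by norm_num)

lemma IsPullbackAt.differentiableAt (H : IsPullbackAt G F h y) : DifferentiableAt ℝ F y :=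
  H.contDiffAt.differentiableAt (by norm_num)

lemma IsPullbackAt.differentiableAt_fderiv (H : IsPullbackAt G F h y) (v : E') :
    DifferentiableAt ℝ (fun p => fderiv ℝ F p v) y :=
  differentiableAt_fderiv_apply H.contDiffAt_two le_rfl v

lemma IsPullbackAt.fderiv_apply (H : IsPullbackAt G F h y) (u a b : E') :
    fderiv ℝ h y u a b = G (F y) (coordHess G F y u a) (fderiv ℝ F y b)
      + G (F y) (fderiv ℝ F y a) (coordHess G F y u b) := by
  rw [← H.pullback.fderiv_apply_const]
  have h₂ : (fun p => h p a b) =ᶠ[𝓝 y] fun p => G (F p) (fderiv ℝ F p a) (fderiv ℝ F p b) := by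
    filter_upwards [H.eq] with p hp using hp a b
  rw [h₂.fderiv_eq, H.metric.fderiv_along H.differentiableAt (H.differentiableAt_fderiv a)
    (H.differentiableAt_fderiv b)]
  rfl

/-- The Levi-Civita connection of the pullback is the tangential part of the ambient one. -/
lemma IsPullbackAt.apply_coordHess (H : IsPullbackAt G F h y) (u v z : E') :
    G (F y) (coordHess G F y u v) (fderiv ℝ F y z) = h y (christoffel h y u v) z := by
  -- The Koszul formula produces six Hessian terms; by symmetry of the Hessian four cancel in pairs
  -- and two agree.
  rw [H.pullback.apply_christoffel, H.fderiv_apply, H.fderiv_apply, H.fderiv_apply,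
    coordHess_comm H.metric H.contDiffAt_two v u, coordHess_comm H.metric H.contDiffAt_two z u,
    coordHess_comm H.metric H.contDiffAt_two z v, H.metric.symm_apply (fderiv ℝ F y v),
    H.metric.symm_apply (fderiv ℝ F y u) (coordHess G F y v z)]
  ring

/-- The Hessian involves two derivatives of F and one of G, so this step consumes the assumptions
that F is C³ and G is C². -/
lemma IsPullbackAt.differentiableAt_coordHess [CompleteSpace E] (H : IsPullbackAt G F h y) (v z : E') :
    DifferentiableAt ℝ (fun p => coordHess G F p v z) y := by
  have h₁ : ContDiffAt ℝ 2 (fderiv ℝ F) y := H.contDiffAt.fderiv_right (by norm_num)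
  have h₂ : ContDiffAt ℝ 2 (fun p => fderiv ℝ F p z) y := h₁.clm_apply contDiffAt_const
  have h₃ := differentiableAt_fderiv_apply h₂ le_rfl v
  have h₄ : DifferentiableAt ℝ (fun p => christoffel G (F p)) y :=
    (H.metric.contDiffAt_christoffel.differentiableAt (by norm_num)).comp y H.differentiableAt
  exact h₃.add ((h₄.clm_apply (H.differentiableAt_fderiv v)).clm_apply
    (H.differentiableAt_fderiv z))

/-- The commutator of covariant derivatives along `F` is the curvature. -/
lemma IsPullbackAt.covAlong_coordHess_sub [CompleteSpace E] (H : IsPullbackAt G F h y)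
    (u v z : E') :
    coordCovAlong G F (fun p => coordHess G F p v z) y u
        - coordCovAlong G F (fun p => coordHess G F p u z) y v
      = coordCurvature G (F y) (fderiv ℝ F y u) (fderiv ℝ F y v) (fderiv ℝ F y z) := by
  have h₁ : ContDiffAt ℝ 2 (fderiv ℝ F) y := H.contDiffAt.fderiv_right (by norm_num)
  have h₂ : ContDiffAt ℝ 2 (fun p => fderiv ℝ F p z) y := h₁.clm_apply contDiffAt_const
  have hΓ : HasFDerivAt (fun p => christoffel G (F p))
      ((fderiv ℝ (christoffel G) (F y)).comp (fderiv ℝ F y)) y :=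
    (H.metric.contDiffAt_christoffel.differentiableAt (by norm_num)).hasFDerivAt.comp y
      H.differentiableAt.hasFDerivAt
  -- After antisymmetrizing in u and v, the third derivative and the term with ∂_u∂_v F vanish and
  -- the two mixed terms exchange roles. What remains, DΓ and ΓΓ, is the curvature.
  have key : ∀ u v, coordCovAlong G F (fun p => coordHess G F p v z) y u
      = fderiv ℝ (fun p => fderiv ℝ (fun q => fderiv ℝ F q z) p v) y u
        + fderiv ℝ (christoffel G) (F y) (fderiv ℝ F y u) (fderiv ℝ F y v) (fderiv ℝ F y z)
        + christoffel G (F y) (fderiv ℝ (fun p => fderiv ℝ F p v) y u) (fderiv ℝ F y z)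
        + christoffel G (F y) (fderiv ℝ F y v) (fderiv ℝ (fun p => fderiv ℝ F p z) y u)
        + christoffel G (F y) (fderiv ℝ F y u) (fderiv ℝ (fun p => fderiv ℝ F p z) y v)
        + christoffel G (F y) (fderiv ℝ F y u)
            (christoffel G (F y) (fderiv ℝ F y v) (fderiv ℝ F y z)) := by
    intro u v
    have h₃ := (differentiableAt_fderiv_apply h₂ le_rfl v).hasFDerivAt
    have h₄ := (hΓ.clm_apply (H.differentiableAt_fderiv v).hasFDerivAt).clm_apply
      (H.differentiableAt_fderiv z).hasFDerivAt
    have h₅ := (h₃.add h₄).fderiv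
    rw [coordCovAlong]
    have h₆ : (fun p => coordHess G F p v z)
        = (fun p => fderiv ℝ (fun q => fderiv ℝ F q z) p v)
          + fun p => christoffel G (F p) (fderiv ℝ F p v) (fderiv ℝ F p z) := by
      ext p; rfl
    rw [h₆, h₅]
    simp [coordHess, coordCovAlong]
    abel
  rw [key, key, fderiv_fderiv_apply_comm h₂ le_rfl u v,
    fderiv_fderiv_apply_comm H.contDiffAt_two le_rfl u v, coordCurvature]
  abel

/-- The Gauss equation. -/
lemma IsPullbackAt.apply_coordCurvature [CompleteSpace E] [CompleteSpace E']
    (H : IsPullbackAt G F h y) (u v z w : E') :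
    h y (coordCurvature h y u v z) w + h y (christoffel h y v z) (christoffel h y u w)
        - h y (christoffel h y u z) (christoffel h y v w)
      = G (F y) (coordCurvature G (F y) (fderiv ℝ F y u) (fderiv ℝ F y v) (fderiv ℝ F y z))
          (fderiv ℝ F y w)
        + G (F y) (coordHess G F y v z) (coordHess G F y u w)
        - G (F y) (coordHess G F y u z) (coordHess G F y v w) := by
  have key : ∀ u v, h y (fderiv ℝ (christoffel h) y u v z
        + christoffel h y u (christoffel h y v z)) w
        + h y (christoffel h y v z) (christoffel h y u w)
      = G (F y) (coordCovAlong G F (fun p => coordHess G F p v z) y u) (fderiv ℝ F y w)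
        + G (F y) (coordHess G F y v z) (coordHess G F y u w) := by
    intro u v
    -- The tangential identity `apply_coordHess` holds near y, so both sides may be differentiated
    -- in the direction u.
    have hev : (fun p => h p (christoffel h p v z) w)
        =ᶠ[𝓝 y] fun p => G (F p) (coordHess G F p v z) (fderiv ℝ F p w) := by
      filter_upwards [H.eventually] with p hp using (hp.apply_coordHess v z w).symm
    have hd := H.pullback.contDiffAt_christoffel.differentiableAt (by norm_num)
    have h₁ := H.pullback.fderiv_field (P := fun p => christoffel h p v z)
      ((hd.clm_apply (differentiableAt_const v)).clm_apply (differentiableAt_const z)) u w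
    rw [hev.fderiv_eq, H.metric.fderiv_along H.differentiableAt (H.differentiableAt_coordHess v z)
      (H.differentiableAt_fderiv w)] at h₁
    have h₂ : fderiv ℝ (fun p => christoffel h p v z) y u
        = fderiv ℝ (christoffel h) y u v z := by
      rw [((hd.hasFDerivAt.clm_apply (hasFDerivAt_const v y)).clm_apply
        (hasFDerivAt_const z y)).fderiv]
      simp
    rw [h₂] at h₁
    exact h₁.symm
  rw [← H.covAlong_coordHess_sub, coordCurvature]
  have h₁ := key u v
  have h₂ := key v u
  simp only [map_sub, sub_apply] at h₁ h₂ ⊢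
  linarith

/-- The derivative of a tensor of endomorphisms compared with that of its tangential part. -/
lemma IsPullbackAt.apply_coordCovDerivEnd (H : IsPullbackAt G F h y) {A : E → E →L[ℝ] E}
    {B : E' → E' →L[ℝ] E'} (hA : DifferentiableAt ℝ A (F y)) (hB : DifferentiableAt ℝ B y)
    (hAB : ∀ᶠ p in 𝓝 y, ∀ a b,
      h p (B p a) b = G (F p) (A (F p) (fderiv ℝ F p a)) (fderiv ℝ F p b)) (w v z : E') :
    h y (coordCovDerivEnd h B y w v) z + h y (B y (christoffel h y w v)) z
        + h y (B y v) (christoffel h y w z)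
      = G (F y) (coordCovDerivEnd G A (F y) (fderiv ℝ F y w) (fderiv ℝ F y v)) (fderiv ℝ F y z)
        + G (F y) (A (F y) (coordHess G F y w v)) (fderiv ℝ F y z)
        + G (F y) (A (F y) (fderiv ℝ F y v)) (coordHess G F y w z) := by
  -- Same method as for the Gauss equation: differentiate the relation between B and A along w.
  have hev : (fun p => h p (B p v) z)
      =ᶠ[𝓝 y] fun p => G (F p) (A (F p) (fderiv ℝ F p v)) (fderiv ℝ F p z) := by
    filter_upwards [hAB] with p hp using hp v z
  have h₁ := H.pullback.fderiv_field (P := fun p => B p v)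
    (hB.clm_apply (differentiableAt_const v)) w z
  have hAF : HasFDerivAt (fun p => A (F p)) ((fderiv ℝ A (F y)).comp (fderiv ℝ F y)) y :=
    hA.hasFDerivAt.comp y H.differentiableAt.hasFDerivAt
  have h₃ := hAF.clm_apply (H.differentiableAt_fderiv v).hasFDerivAt
  rw [hev.fderiv_eq, H.metric.fderiv_along H.differentiableAt h₃.differentiableAt
    (H.differentiableAt_fderiv z)] at h₁
  have h₂ : fderiv ℝ (fun p => B p v) y w = fderiv ℝ B y w v := by
    rw [(hB.hasFDerivAt.clm_apply (hasFDerivAt_const v y)).fderiv]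
    simp
  rw [h₂] at h₁
  have h₄ : coordCovAlong G F (fun p => A (F p) (fderiv ℝ F p v)) y w
      = coordCovDerivEnd G A (F y) (fderiv ℝ F y w) (fderiv ℝ F y v)
        + A (F y) (coordHess G F y w v) := by
    rw [coordCovAlong, h₃.fderiv]
    simp [coordCovDerivEnd, coordHess, coordCovAlong]
    abel
  rw [h₄] at h₁
  simp only [coordCovDerivEnd, coordHess, map_add, map_sub, add_apply, sub_apply] at h₁ ⊢
  linarith

/-- The Weingarten equation. -/
lemma IsPullbackAt.apply_coordHess_normal (H : IsPullbackAt G F h y) {ν : E' → E}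
    (hν : DifferentiableAt ℝ ν y)
    (hperp : ∀ᶠ p in 𝓝 y, ∀ a, G (F p) (fderiv ℝ F p a) (ν p) = 0) (u z : E') :
    G (F y) (coordHess G F y u z) (ν y) = - G (F y) (coordCovAlong G F ν y u) (fderiv ℝ F y z) := by
  have hev : (fun p => G (F p) (fderiv ℝ F p z) (ν p)) =ᶠ[𝓝 y] fun _ => (0 : ℝ) := by
    filter_upwards [hperp] with p hp using hp z
  have h₁ := H.metric.fderiv_along H.differentiableAt (H.differentiableAt_fderiv z) hν u
  rw [hev.fderiv_eq] at h₁
  rw [H.metric.symm_apply (coordCovAlong G F ν y u)]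
  simp only [fderiv_fun_const, Pi.zero_apply, zero_apply] at h₁
  rw [coordHess]
  linarith

/-- The image of the differential of `F` at `y` together with the unit normal vector `ν y` spans
the ambient space, and `ν` is normal to `F` near `y`. -/
structure IsUnitNormalAt (G : E → E →L[ℝ] E →L[ℝ] ℝ) (F ν : E' → E) (y : E') : Prop where
  differentiableAt : DifferentiableAt ℝ ν y
  perp : ∀ᶠ p in 𝓝 y, ∀ a, G (F p) (fderiv ℝ F p a) (ν p) = 0
  unit : G (F y) (ν y) (ν y) = 1
  eq_zero : ∀ a, (∀ z, G (F y) a (fderiv ℝ F y z) = 0) → G (F y) a (ν y) = 0 → a = 0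

/-- The second fundamental form with respect to `ν`, in the form given by the Weingarten
equation. -/
def coordSecondForm (G : E → E →L[ℝ] E →L[ℝ] ℝ) (F ν : E' → E) (y u v : E') : ℝ :=
  - G (F y) (coordCovAlong G F ν y u) (fderiv ℝ F y v)

/-! ### Codimension one: the second fundamental form as a scalar form. -/

section Hypersurface

variable {ν : E' → E} (H : IsPullbackAt G F h y) (Hν : IsUnitNormalAt G F ν y)
include H Hν

/-- The Gauss formula. -/
lemma IsPullbackAt.coordHess_eq (u v : E') :
    coordHess G F y u v
      = fderiv ℝ F y (christoffel h y u v) + coordSecondForm G F ν y u v • ν y := by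
  rw [← sub_eq_zero]
  apply Hν.eq_zero
  · intro z
    simp only [map_sub, map_add, map_smul, sub_apply, add_apply, smul_apply, smul_eq_mul]
    rw [H.apply_coordHess, H.metric.symm_apply (ν y), Hν.perp.self_of_nhds,
      H.eq.self_of_nhds]
    ring
  · simp only [map_sub, map_add, map_smul, sub_apply, add_apply, smul_apply, smul_eq_mul]
    rw [H.apply_coordHess_normal Hν.differentiableAt Hν.perp, Hν.perp.self_of_nhds, Hν.unit,
      coordSecondForm]
    ring

/-- By the Weingarten equation both sides are normal components of the symmetric Hessian. -/
lemma IsPullbackAt.coordSecondForm_comm (u v : E') :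
    coordSecondForm G F ν y u v = coordSecondForm G F ν y v u := by
  rw [coordSecondForm, coordSecondForm,
    ← H.apply_coordHess_normal Hν.differentiableAt Hν.perp,
    ← H.apply_coordHess_normal Hν.differentiableAt Hν.perp,
    coordHess_comm H.metric H.contDiffAt_two]

/-- Inner products of Hessians split into a tangential part, which cancels the Christoffel products
in `apply_coordCurvature`, and a product of second fundamental forms. -/
lemma IsPullbackAt.gauss_equation [CompleteSpace E] [CompleteSpace E'] (u v z w : E') :
    h y (coordCurvature h y u v z) w
      = G (F y) (coordCurvature G (F y) (fderiv ℝ F y u) (fderiv ℝ F y v) (fderiv ℝ F y z))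
          (fderiv ℝ F y w)
        + coordSecondForm G F ν y v z * coordSecondForm G F ν y u w
        - coordSecondForm G F ν y u z * coordSecondForm G F ν y v w := by
  have key : ∀ a b c d, G (F y) (coordHess G F y a b) (coordHess G F y c d)
      = h y (christoffel h y a b) (christoffel h y c d)
        + coordSecondForm G F ν y a b * coordSecondForm G F ν y c d := by
    intro a b c d
    rw [H.coordHess_eq Hν, H.coordHess_eq Hν]
    simp only [map_add, map_smul, add_apply, smul_apply, smul_eq_mul]
    rw [H.metric.symm_apply (ν y) (fderiv ℝ F y _), Hν.perp.self_of_nhds, Hν.perp.self_of_nhds,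
      Hν.unit, H.eq.self_of_nhds]
    ring
  have := H.apply_coordCurvature u v z w
  rw [key, key] at this
  linarith

/-- The Gauss formula is inserted into both Hessian terms of `apply_coordCovDerivEnd`. Tangential
parts cancel through `hAB`; each normal part leaves one product. -/
lemma IsPullbackAt.covDerivEnd_equation {A : E → E →L[ℝ] E} {B : E' → E' →L[ℝ] E'}
    (hA : DifferentiableAt ℝ A (F y)) (hB : DifferentiableAt ℝ B y)
    (hAB : ∀ᶠ p in 𝓝 y, ∀ a b,
      h p (B p a) b = G (F p) (A (F p) (fderiv ℝ F p a)) (fderiv ℝ F p b)) (w v z : E') :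
    h y (coordCovDerivEnd h B y w v) z
      = G (F y) (coordCovDerivEnd G A (F y) (fderiv ℝ F y w) (fderiv ℝ F y v)) (fderiv ℝ F y z)
        + coordSecondForm G F ν y w v * G (F y) (A (F y) (ν y)) (fderiv ℝ F y z)
        + coordSecondForm G F ν y w z * G (F y) (A (F y) (fderiv ℝ F y v)) (ν y) := by
  have := H.apply_coordCovDerivEnd hA hB hAB w v z
  rw [H.coordHess_eq Hν, H.coordHess_eq Hν] at this
  simp only [map_add, map_smul, add_apply, smul_apply, smul_eq_mul] at this
  rw [← hAB.self_of_nhds, ← hAB.self_of_nhds] at this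
  linarith

end Hypersurface

end Pullback

end Coordinates

/-! ### Dictionary between tensors on a manifold and their chart components. -/

section Charts

set_option linter.unusedSectionVars false

variable {E : Type*} [NormedAddCommGroup E] [NormedSpace ℝ E]
  {H : Type*} [TopologicalSpace H] {I : ModelWithCorners ℝ E H}
  {M : Type*} [TopologicalSpace M] [ChartedSpace H M]

/-- The differential at `p` of the chart around `x₀`. -/
def toCoordAt (I : ModelWithCorners ℝ E H) (x₀ p : M) : TangentSpace I p →L[ℝ] E :=
  mvfderiv I (extChartAt I x₀) p

variable [IsManifold I ∞ M] [I.Boundaryless]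

/-- Without boundary the range of `I` is the whole space, so the derivative of the inverse chart
within the range is an ordinary derivative. -/
lemma toCoordAt_ofCoordAt {x₀ : M} {y : E} (hy : y ∈ (extChartAt I x₀).target) (e : E) :
    toCoordAt I x₀ ((extChartAt I x₀).symm y) (ofCoordAt x₀ y e) = e := by
  have h := mfderiv_extChartAt_comp_mfderivWithin_extChartAt_symm hy
  rw [I.range_eq_univ, mfderivWithin_univ] at h
  exact congrArg (fun L => L e) h

lemma ofCoordAt_toCoordAt {x₀ : M} {y : E} (hy : y ∈ (extChartAt I x₀).target)
    (v : TangentSpace I ((extChartAt I x₀).symm y)) :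
    ofCoordAt x₀ y (toCoordAt I x₀ ((extChartAt I x₀).symm y) v) = v := by
  have h := mfderivWithin_extChartAt_symm_comp_mfderiv_extChartAt hy
  rw [I.range_eq_univ, mfderivWithin_univ] at h
  exact congrArg (fun L => L v) h

lemma isInvertible_ofCoordAt {x₀ : M} {y : E} (hy : y ∈ (extChartAt I x₀).target) :
    (ofCoordAt x₀ y : E →L[ℝ] TangentSpace I ((extChartAt I x₀).symm y)).IsInvertible :=
  ContinuousLinearMap.IsInvertible.of_inverse (g := toCoordAt I x₀ ((extChartAt I x₀).symm y))
    (ContinuousLinearMap.ext fun v => ofCoordAt_toCoordAt hy v)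
    (ContinuousLinearMap.ext fun v => toCoordAt_ofCoordAt hy v)

lemma toCoord_isInvertible (x : M) : (toCoord x : TangentSpace I x →L[ℝ] E).IsInvertible := by
  exact isInvertible_mfderiv_extChartAt (mem_extChartAt_source x)

lemma toCoord_ofCoord (x : M) (e : E) : toCoord x (ofCoord x e : TangentSpace I x) = e :=
  (toCoord_isInvertible x).self_apply_inverse e

lemma coordForm_toCoordAt (b : BilinField I M) {x₀ p : M} (hp : p ∈ (extChartAt I x₀).source)
    (v w : TangentSpace I p) :
    coordForm b x₀ (extChartAt I x₀ p) (toCoordAt I x₀ p v) (toCoordAt I x₀ p w) = b p v w := by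
  obtain ⟨y, hy, rfl⟩ : ∃ y ∈ (extChartAt I x₀).target, (extChartAt I x₀).symm y = p :=
    ⟨_, (extChartAt I x₀).map_source hp, (extChartAt I x₀).left_inv hp⟩
  rw [(extChartAt I x₀).right_inv hy]
  simp only [coordForm, ContinuousLinearMap.comp_apply, ContinuousLinearMap.precomp_apply,
    ofCoordAt_toCoordAt hy]

lemma coordForm_toCoord (b : BilinField I M) (x : M) (v w : TangentSpace I x) :
    coordForm b x (extChartAt I x x) (toCoord x v) (toCoord x w) = b x v w :=
  coordForm_toCoordAt b (mem_extChartAt_source x) v w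

/-- A coordinate vector field has constant fibre component `e` in the trivialization at `x₀`, hence
is smooth. -/
lemma contMDiffAt_ofCoordAt {x₀ : M} {y : E} (hy : y ∈ (extChartAt I x₀).target) (e : E) :
    ContMDiffAt 𝓘(ℝ, E) I.tangent ∞
      (fun y => (⟨(extChartAt I x₀).symm y, ofCoordAt x₀ y e⟩ : TangentBundle I M)) y := by
  have hy' : (extChartAt I x₀).symm y ∈ (chartAt H x₀).source := by
    rw [← extChartAt_source I]; exact (extChartAt I x₀).map_target hy
  have ht : (extChartAt I x₀).target ∈ 𝓝 y := (isOpen_extChartAt_target x₀).mem_nhds hy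
  rw [(trivializationAt E (TangentSpace I) x₀).contMDiffAt_iff
    (by simpa [TangentBundle.trivializationAt_baseSet] using hy')]
  refine ⟨(contMDiffOn_extChartAt_symm x₀).contMDiffAt ht, ?_⟩
  refine (contMDiffAt_const (c := e)).congr_of_eventuallyEq ?_
  filter_upwards [ht] with z hz
  have hz' : (extChartAt I x₀).symm z ∈ (chartAt H x₀).source := by
    rw [← extChartAt_source I]; exact (extChartAt I x₀).map_target hz
  have h := TangentBundle.continuousLinearMapAt_trivializationAt (I := I) hz'
  have h2 := congrArg (fun L => L (ofCoordAt x₀ z e)) h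
  refine Eq.trans ?_ (h2.trans (toCoordAt_ofCoordAt hz e))
  rw [Trivialization.continuousLinearMapAt_apply, Trivialization.linearMapAt_apply, if_pos]
  simpa [TangentBundle.trivializationAt_baseSet] using hz'

/-- The components of a smooth field of bilinear forms are smooth. -/
lemma contDiffOn_coordForm [FiniteDimensional ℝ E] {b : BilinField I M}
    (hb : ContMDiff I (I.prod 𝓘(ℝ, E →L[ℝ] E →L[ℝ] ℝ)) ∞
      (fun x : M => TotalSpace.mk' (E →L[ℝ] E →L[ℝ] ℝ)
        (E := fun x : M => TangentSpace I x →L[ℝ] TangentSpace I x →L[ℝ] ℝ) x (b x))) (x₀ : M) :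
    ContDiffOn ℝ ∞ (coordForm b x₀) (extChartAt I x₀).target := by
  rw [contDiffOn_clm_apply]
  intro e
  rw [contDiffOn_clm_apply]
  intro e' y hy
  have ht : (extChartAt I x₀).target ∈ 𝓝 y := (isOpen_extChartAt_target x₀).mem_nhds hy
  have : ContMDiffAt 𝓘(ℝ, E) (I.prod 𝓘(ℝ)) ∞
      (fun m ↦ TotalSpace.mk' ℝ (E := Bundle.Trivial M ℝ) ((extChartAt I x₀).symm m)
        (b ((extChartAt I x₀).symm m) (ofCoordAt x₀ m e) (ofCoordAt x₀ m e'))) y := by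
    apply ContMDiffAt.clm_bundle_apply₂ (F₁ := E) (F₂ := E)
    · exact ContMDiffAt.comp y hb.contMDiffAt ((contMDiffOn_extChartAt_symm x₀).contMDiffAt ht)
    · exact contMDiffAt_ofCoordAt hy e
    · exact contMDiffAt_ofCoordAt hy e'
  simp only [contMDiffAt_totalSpace] at this
  exact this.2.contDiffAt.contDiffWithinAt

end Charts

/-! ### Immersions and fields along them in charts. -/

section Immersions

set_option linter.unusedSectionVars false

variable {E : Type*} [NormedAddCommGroup E] [NormedSpace ℝ E]
  {H : Type*} [TopologicalSpace H] {I : ModelWithCorners ℝ E H}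
  {M : Type*} [TopologicalSpace M] [ChartedSpace H M] [IsManifold I ∞ M] [I.Boundaryless]
  {E' : Type*} [NormedAddCommGroup E'] [NormedSpace ℝ E']
  {H' : Type*} [TopologicalSpace H'] {J : ModelWithCorners ℝ E' H'}
  {N : Type*} [TopologicalSpace N] [ChartedSpace H' N] [IsManifold J ∞ N] [J.Boundaryless]

lemma mvfderiv_eq_fderiv_coord {f : N → E} {x p : N} (hp : p ∈ (extChartAt J x).source)
    (hf : MDifferentiableAt J 𝓘(ℝ, E) f p) (w : TangentSpace J p) :
    mvfderiv J f p w
      = fderiv ℝ (f ∘ (extChartAt J x).symm) (extChartAt J x p) (toCoordAt J x p w) := by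
  have hinv : (extChartAt J x).symm (extChartAt J x p) = p := (extChartAt J x).left_inv hp
  have ht := (extChartAt J x).map_source hp
  have hsymm : MDifferentiableAt 𝓘(ℝ, E') J (extChartAt J x).symm (extChartAt J x p) := by
    have := mdifferentiableWithinAt_extChartAt_symm ht
    rwa [J.range_eq_univ, mdifferentiableWithinAt_univ] at this
  have hg : MDifferentiableAt 𝓘(ℝ, E') 𝓘(ℝ, E) (f ∘ (extChartAt J x).symm) (extChartAt J x p) :=
    MDifferentiableAt.comp _ (by rwa [hinv]) hsymm
  have hφ : MDifferentiableAt J 𝓘(ℝ, E') (extChartAt J x) p :=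
    mdifferentiableAt_extChartAt (by rwa [← extChartAt_source J])
  have hcomp := hg.hasMFDerivAt.comp p hφ.hasMFDerivAt
  have hev : f =ᶠ[𝓝 p] (f ∘ (extChartAt J x).symm) ∘ extChartAt J x := by
    filter_upwards [(isOpen_extChartAt_source x).mem_nhds hp] with q hq
    simp only [Function.comp_apply, (extChartAt J x).left_inv hq]
  have h := (hcomp.congr_of_eventuallyEq hev).mfderiv
  rw [mfderiv_eq_fderiv] at h
  exact congrArg (fun L => L w) h

/-- The coordinate expression of `ι` in the charts around `x` and `ι x`. -/
def localRep (J : ModelWithCorners ℝ E' H') (I : ModelWithCorners ℝ E H) (ι : N → M) (x : N) :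
    E' → E :=
  (extChartAt I (ι x) ∘ ι) ∘ (extChartAt J x).symm

omit [IsManifold I ∞ M] [I.Boundaryless] [IsManifold J ∞ N] [J.Boundaryless] in
lemma localRep_extChartAt (ι : N → M) {x p : N} (hp : p ∈ (extChartAt J x).source) :
    localRep J I ι x (extChartAt J x p) = extChartAt I (ι x) (ι p) := by
  simp only [localRep, Function.comp_apply, (extChartAt J x).left_inv hp]

lemma toCoordAt_mfderiv {ι : N → M} (hι : ContMDiff J I ∞ ι) {x p : N}
    (hp : p ∈ (extChartAt J x).source) (hp' : ι p ∈ (extChartAt I (ι x)).source)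
    (w : TangentSpace J p) :
    toCoordAt I (ι x) (ι p) (mfderiv J I ι p w)
      = fderiv ℝ (localRep J I ι x) (extChartAt J x p) (toCoordAt J x p w) := by
  have hφ : MDifferentiableAt I 𝓘(ℝ, E) (extChartAt I (ι x)) (ι p) :=
    mdifferentiableAt_extChartAt (by rwa [← extChartAt_source I])
  have hιd : MDifferentiableAt J I ι p := hι.mdifferentiableAt (by simp)
  rw [localRep, ← mvfderiv_eq_fderiv_coord hp (hφ.comp p hιd)]
  have h := mfderiv_comp p hφ hιd
  exact (congrArg (fun L => L w) h).symm

lemma contDiffAt_localRep {ι : N → M} (hι : ContMDiff J I ∞ ι) {x : N} {y : E'}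
    (hy : y ∈ (extChartAt J x).target)
    (hy' : ι ((extChartAt J x).symm y) ∈ (extChartAt I (ι x)).source) :
    ContDiffAt ℝ ∞ (localRep J I ι x) y := by
  have ht : (extChartAt J x).target ∈ 𝓝 y := (isOpen_extChartAt_target x).mem_nhds hy
  have h₁ : ContMDiffAt 𝓘(ℝ, E') J ∞ (extChartAt J x).symm y :=
    (contMDiffOn_extChartAt_symm x).contMDiffAt ht
  have h₂ : ContMDiffAt I 𝓘(ℝ, E) ∞ (extChartAt I (ι x)) (ι ((extChartAt J x).symm y)) :=
    contMDiffAt_extChartAt' (by rwa [← extChartAt_source I])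
  exact ((h₂.comp _ hι.contMDiffAt).comp y h₁).contDiffAt

lemma eventually_mem_chart {ι : N → M} (hι : ContMDiff J I ∞ ι) (x : N) :
    ∀ᶠ y in 𝓝 (extChartAt J x x), y ∈ (extChartAt J x).target ∧
      ι ((extChartAt J x).symm y) ∈ (extChartAt I (ι x)).source := by
  have h₁ : (extChartAt J x).target ∈ 𝓝 (extChartAt J x x) :=
    (isOpen_extChartAt_target x).mem_nhds (mem_extChartAt_target x)
  have h₂ : ContinuousAt (fun y => ι ((extChartAt J x).symm y)) (extChartAt J x x) :=
    hι.continuous.continuousAt.comp (continuousAt_extChartAt_symm x)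
  have h₃ : (extChartAt I (ι x)).source ∈ 𝓝 (ι ((extChartAt J x).symm (extChartAt J x x))) := by
    rw [extChartAt_to_inv]
    exact extChartAt_source_mem_nhds (ι x)
  filter_upwards [h₁, h₂.eventually h₃] with y hy hy' using ⟨hy, hy'⟩

section Target

variable {ι : N → M} (hι : ContMDiff J I ∞ ι) {x : N} {y : E'}
  (hy : y ∈ (extChartAt J x).target)
  (hy' : ι ((extChartAt J x).symm y) ∈ (extChartAt I (ι x)).source)
include hι hy hy'

lemma toCoordAt_mfderiv_ofCoordAt (e : E') :
    toCoordAt I (ι x) (ι ((extChartAt J x).symm y))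
        (mfderiv J I ι ((extChartAt J x).symm y) (ofCoordAt x y e))
      = fderiv ℝ (localRep J I ι x) y e := by
  rw [toCoordAt_mfderiv hι ((extChartAt J x).map_target hy) hy', toCoordAt_ofCoordAt hy,
    (extChartAt J x).right_inv hy]

lemma coordForm_pullbackForm (b : BilinField I M) (a a' : E') :
    coordForm (pullbackForm J b ι) x y a a'
      = coordForm b (ι x) (localRep J I ι x y) (fderiv ℝ (localRep J I ι x) y a)
          (fderiv ℝ (localRep J I ι x) y a') := by
  rw [← toCoordAt_mfderiv_ofCoordAt hι hy hy', ← toCoordAt_mfderiv_ofCoordAt hι hy hy']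
  exact (coordForm_toCoordAt b hy' _ _).symm

lemma coordForm_mfderiv_coordAlong (b : BilinField I M) (V : ∀ p : N, TangentSpace I (ι p))
    (a : E') :
    coordForm b (ι x) (localRep J I ι x y) (fderiv ℝ (localRep J I ι x) y a)
        (coordAlong ι V x ((extChartAt J x).symm y))
      = b (ι ((extChartAt J x).symm y))
          (mfderiv J I ι ((extChartAt J x).symm y) (ofCoordAt x y a))
          (V ((extChartAt J x).symm y)) := by
  rw [← toCoordAt_mfderiv_ofCoordAt hι hy hy']
  exact coordForm_toCoordAt b hy' _ _

end Target

/-- Near x, `coordAlong` is the fibre component of V in the tangent bundle trivialization at `ι x`.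
-/
lemma contMDiffAt_coordAlong {ι : N → M} {V : ∀ p : N, TangentSpace I (ι p)}
    (hV : ContMDiff J I.tangent ∞ (fun p : N => (⟨ι p, V p⟩ : TangentBundle I M))) (x : N) :
    ContMDiffAt J 𝓘(ℝ, E) ∞ (coordAlong ι V x) x := by
  have h := hV x
  rw [contMDiffAt_totalSpace] at h
  have hc : ContinuousAt ι x := h.1.continuousAt
  refine h.2.congr_of_eventuallyEq ?_
  filter_upwards [hc.eventually ((chartAt H (ι x)).open_source.mem_nhds (mem_chart_source H (ι x)))]
    with p hp
  have h := TangentBundle.continuousLinearMapAt_trivializationAt (I := I) hp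
  refine ((congrArg (fun L => L (V p)) h).symm).trans ?_
  rw [Trivialization.continuousLinearMapAt_apply, Trivialization.linearMapAt_apply, if_pos]
  rw [TangentBundle.trivializationAt_baseSet]
  exact hp

lemma differentiableAt_coordAlong {ι : N → M} {V : ∀ p : N, TangentSpace I (ι p)}
    (hV : ContMDiff J I.tangent ∞ (fun p : N => (⟨ι p, V p⟩ : TangentBundle I M))) (x : N) :
    DifferentiableAt ℝ (coordAlong ι V x ∘ (extChartAt J x).symm) (extChartAt J x x) := by
  have h₁ : ContMDiffAt 𝓘(ℝ, E') J ∞ (extChartAt J x).symm (extChartAt J x x) :=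
    (contMDiffOn_extChartAt_symm x).contMDiffAt
      ((isOpen_extChartAt_target x).mem_nhds (mem_extChartAt_target x))
  have h₂ := ContMDiffAt.comp_of_eq (contMDiffAt_coordAlong hV x) h₁ (extChartAt_to_inv x)
  exact h₂.contDiffAt.differentiableAt (by simp)

end Immersions

/-- A positive definite bilinear form on a finite-dimensional space is nondegenerate. -/
lemma isInvertible_of_pos {V : Type*} [AddCommGroup V] [Module ℝ V] [TopologicalSpace V]
    [IsTopologicalAddGroup V] [ContinuousSMul ℝ V] [T2Space V] [FiniteDimensional ℝ V]
    (b : V →L[ℝ] V →L[ℝ] ℝ) (hb : ∀ v, v ≠ 0 → 0 < b v v) : b.IsInvertible := by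
  have hinj : Function.Injective b := by
    rw [injective_iff_map_eq_zero]
    intro v hv
    by_contra hne
    have := hb v hne
    simp [hv] at this
  let e₀ : (V →L[ℝ] ℝ) ≃ₗ[ℝ] (V →ₗ[ℝ] ℝ) := LinearMap.toContinuousLinearMap.symm
  have : FiniteDimensional ℝ (V →L[ℝ] ℝ) := e₀.symm.finiteDimensional
  have hdim : Module.finrank ℝ V = Module.finrank ℝ (V →L[ℝ] ℝ) := by
    rw [e₀.finrank_eq]
    exact (Subspace.dual_finrank_eq).symm
  let e := LinearEquiv.ofInjectiveOfFinrankEq (b : V →ₗ[ℝ] V →L[ℝ] ℝ) hinj hdim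
  exact ⟨e.toContinuousLinearEquiv, by ext v w; rfl⟩

section Instances

variable {E : Type*} [NormedAddCommGroup E] [NormedSpace ℝ E]
  {H : Type*} [TopologicalSpace H] (I : ModelWithCorners ℝ E H)
  {M : Type*} [TopologicalSpace M] [ChartedSpace H M]

instance (x : M) : T2Space (TangentSpace I x) := inferInstanceAs (T2Space E)

instance [FiniteDimensional ℝ E] (x : M) : FiniteDimensional ℝ (TangentSpace I x) :=
  inferInstanceAs (FiniteDimensional ℝ E)

end Instances

/-! ### Magnetic systems and induced systems in coordinates. -/

section Systems

variable {E : Type*} [NormedAddCommGroup E] [NormedSpace ℝ E] [FiniteDimensional ℝ E]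
  {H : Type*} [TopologicalSpace H] {I : ModelWithCorners ℝ E H}
  {M : Type*} [TopologicalSpace M] [ChartedSpace H M] [IsManifold I ∞ M] [I.Boundaryless]
  {E' : Type*} [NormedAddCommGroup E'] [NormedSpace ℝ E'] [FiniteDimensional ℝ E']
  {H' : Type*} [TopologicalSpace H'] {J : ModelWithCorners ℝ E' H'}
  {N : Type*} [TopologicalSpace N] [ChartedSpace H' N] [IsManifold J ∞ N] [J.Boundaryless]

set_option linter.unusedSectionVars false

lemma apply_lorentzForce {g : BilinField I M} {x : M} (hg : (g x).IsInvertible)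
    (σ : BilinField I M) (v w : TangentSpace I x) : g x (lorentzForce g σ x v) w = σ x v w := by
  simp [lorentzForce, hg.self_apply_inverse]

lemma coordForm_coordEnd (b : BilinField I M) (A : EndField I M) {x₀ : M} {y : E}
    (hy : y ∈ (extChartAt I x₀).target) (u v : E) :
    coordForm b x₀ y (coordEnd A x₀ y u) v
      = b ((extChartAt I x₀).symm y) (A ((extChartAt I x₀).symm y) (ofCoordAt x₀ y u))
          (ofCoordAt x₀ y v) := by
  simp only [coordForm, coordEnd, ContinuousLinearMap.comp_apply,
    ContinuousLinearMap.precomp_apply]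
  rw [(isInvertible_ofCoordAt hy).self_apply_inverse]

lemma coordForm_coordEnd_lorentzForce {g : BilinField I M} (σ : BilinField I M) {x₀ : M} {y : E}
    (hy : y ∈ (extChartAt I x₀).target) (hg : (g ((extChartAt I x₀).symm y)).IsInvertible)
    (u v : E) :
    coordForm g x₀ y (coordEnd (lorentzForce g σ) x₀ y u) v = coordForm σ x₀ y u v := by
  rw [coordForm_coordEnd _ _ hy, apply_lorentzForce hg]
  rfl

lemma toCoordAt_apply_end (A : EndField I M) {x₀ p : M} (hp : p ∈ (extChartAt I x₀).source)
    (v : TangentSpace I p) :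
    toCoordAt I x₀ p (A p v) = coordEnd A x₀ (extChartAt I x₀ p) (toCoordAt I x₀ p v) := by
  obtain ⟨y, hy, rfl⟩ : ∃ y ∈ (extChartAt I x₀).target, (extChartAt I x₀).symm y = p :=
    ⟨_, (extChartAt I x₀).map_source hp, (extChartAt I x₀).left_inv hp⟩
  rw [(extChartAt I x₀).right_inv hy]
  simp only [coordEnd, ContinuousLinearMap.comp_apply, ofCoordAt_toCoordAt hy]
  rw [eq_comm, (isInvertible_ofCoordAt hy).inverse_apply_eq, ofCoordAt_toCoordAt hy]

/-- A field of positive definite symmetric bilinear forms with twice differentiable components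
has as components a metric. -/
lemma isMetricAt_coordForm {g : BilinField I M} (hsymm : ∀ x v w, g x v w = g x w v)
    (hpos : ∀ x v, v ≠ 0 → 0 < g x v v) {x₀ : M} {y : E} (hy : y ∈ (extChartAt I x₀).target)
    (hg : ContDiffAt ℝ 2 (coordForm g x₀) y) : IsMetricAt (coordForm g x₀) y := by
  refine ⟨hg, Eventually.of_forall fun y' a b => hsymm _ _ _, ?_⟩
  refine isInvertible_of_pos _ fun v hv => hpos _ _ fun h0 => hv ?_
  exact (isInvertible_ofCoordAt hy).injective (h0.trans (map_zero _).symm)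

/-- In components the Lorentz force is the inverse metric matrix composed with σ, and inversion is
smooth at invertible maps. -/
lemma differentiableAt_coordEnd_lorentzForce {g σ : BilinField I M}
    (hsymm : ∀ x v w, g x v w = g x w v)
    (hpos : ∀ x v, v ≠ 0 → 0 < g x v v) {x₀ : M} {y : E} (hy : y ∈ (extChartAt I x₀).target)
    (hg : ContDiffAt ℝ 2 (coordForm g x₀) y) (hσ : DifferentiableAt ℝ (coordForm σ x₀) y) :
    DifferentiableAt ℝ (coordEnd (lorentzForce g σ) x₀) y := by
  have hm := isMetricAt_coordForm hsymm hpos hy hg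
  have hinv : DifferentiableAt ℝ (fun p => (coordForm g x₀ p).inverse) y :=
    ((hm.isInvertible.contDiffAt_map_inverse (n := 1)).differentiableAt (by norm_num)).comp y
      hm.differentiableAt
  refine (hinv.clm_comp hσ).congr_of_eventuallyEq ?_
  filter_upwards [(isOpen_extChartAt_target x₀).mem_nhds hy, hm.eventually] with p hp hp'
  ext u
  rw [ContinuousLinearMap.comp_apply, eq_comm, hp'.isInvertible.inverse_apply_eq]
  ext v
  exact (coordForm_coordEnd_lorentzForce σ hp (isInvertible_of_pos _ (hpos _)) u v).symm

lemma MagneticSystem.pos (S : MagneticSystem I M) (x : M) (v : TangentSpace I x) (hv : v ≠ 0) :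
    0 < S.g x v v := S.metric.pos x v hv

lemma MagneticSystem.symm (S : MagneticSystem I M) (x : M) (v w : TangentSpace I x) :
    S.g x v w = S.g x w v := S.metric.symm x v w

section Immersion

variable (S : MagneticSystem I M) {ι : N → M} (hι : ContMDiff J I ∞ ι)
  (hinj : ∀ x : N, Function.Injective (mfderiv J I ι x))

lemma MagneticSystem.inducedMetric_symm (x : N) (v w : TangentSpace J x) :
    S.inducedMetric J ι x v w = S.inducedMetric J ι x w v := S.metric.symm _ _ _

include hinj in
lemma MagneticSystem.inducedMetric_pos (x : N) (v : TangentSpace J x) (hv : v ≠ 0) :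
    0 < S.inducedMetric J ι x v v :=
  S.metric.pos _ _ fun h0 => hv (hinj x (h0.trans (map_zero _).symm))

-- Regularity is read off from the formula (b ∘ F)(dF ·, dF ·), which holds near the centre of the
-- chart.
include hι in
lemma contDiffAt_coordForm_pullbackForm {b : BilinField I M}
    (hb : ContMDiff I (I.prod 𝓘(ℝ, E →L[ℝ] E →L[ℝ] ℝ)) ∞
      (fun x : M => TotalSpace.mk' (E →L[ℝ] E →L[ℝ] ℝ)
        (E := fun x : M => TangentSpace I x →L[ℝ] TangentSpace I x →L[ℝ] ℝ) x (b x))) (x : N) :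
    ContDiffAt ℝ 2 (coordForm (pullbackForm J b ι) x) (extChartAt J x x) := by
  have hev := eventually_mem_chart (I := I) hι x
  obtain ⟨hy, hy'⟩ := hev.self_of_nhds
  have hF : ContDiffAt ℝ 3 (localRep J I ι x) (extChartAt J x x) :=
    (contDiffAt_localRep hι hy hy').of_le (by exact_mod_cast ENat.LEInfty.out)
  have hF' : ContDiffAt ℝ 2 (fderiv ℝ (localRep J I ι x)) (extChartAt J x x) :=
    hF.fderiv_right (by norm_num)
  have hx : localRep J I ι x (extChartAt J x x) ∈ (extChartAt I (ι x)).target := by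
    rw [localRep_extChartAt ι (mem_extChartAt_source x)]
    exact mem_extChartAt_target (ι x)
  have hG : ContDiffAt ℝ 2 (coordForm b (ι x)) (localRep J I ι x (extChartAt J x x)) :=
    ((contDiffOn_coordForm hb (ι x)).contDiffAt
      ((isOpen_extChartAt_target (ι x)).mem_nhds hx)).of_le (by exact_mod_cast ENat.LEInfty.out)
  have hGF := hG.comp (extChartAt J x x) (hF.of_le (by norm_num))
  have hpre : ContDiffAt ℝ 2 (fun p => (ContinuousLinearMap.compL ℝ E' E ℝ).flip
      (fderiv ℝ (localRep J I ι x) p)) (extChartAt J x x) :=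
    ((ContinuousLinearMap.compL ℝ E' E ℝ).flip).contDiff.contDiffAt.comp _ hF'
  refine (hpre.clm_comp (hGF.clm_comp hF')).congr_of_eventuallyEq ?_
  filter_upwards [hev] with y hy
  ext a a'
  rw [coordForm_pullbackForm hι hy.1 hy.2]
  rfl

include hι hinj in
lemma MagneticSystem.isPullbackAt (x : N) :
    IsPullbackAt (coordForm S.g (ι x)) (localRep J I ι x) (coordForm (S.inducedMetric J ι) x)
      (extChartAt J x x) := by
  have hev := eventually_mem_chart (I := I) hι x
  obtain ⟨hy, hy'⟩ := hev.self_of_nhds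
  have hx : localRep J I ι x (extChartAt J x x) ∈ (extChartAt I (ι x)).target := by
    rw [localRep_extChartAt ι (mem_extChartAt_source x)]
    exact mem_extChartAt_target (ι x)
  refine ⟨isMetricAt_coordForm S.symm S.pos hx ?_, ?_,
    isMetricAt_coordForm S.inducedMetric_symm (S.inducedMetric_pos hinj) hy ?_, ?_⟩
  · exact ((contDiffOn_coordForm S.metric.contMDiff (ι x)).contDiffAt
      ((isOpen_extChartAt_target (ι x)).mem_nhds hx)).of_le (by exact_mod_cast ENat.LEInfty.out)
  · exact (contDiffAt_localRep hι hy hy').of_le (by exact_mod_cast ENat.LEInfty.out)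
  · exact contDiffAt_coordForm_pullbackForm hι S.metric.contMDiff x
  · filter_upwards [hev] with y hy a b using coordForm_pullbackForm hι hy.1 hy.2 S.g a b

end Immersion

end Systems

/-- A hyperplane and a transversal unit normal vector span the space. -/
lemma exists_eq_add_smul {V W : Type*} [AddCommGroup V] [Module ℝ V] [FiniteDimensional ℝ V]
    [AddCommGroup W] [Module ℝ W] [FiniteDimensional ℝ W] (L : V →ₗ[ℝ] W)
    (hL : Function.Injective L) (α : W →ₗ[ℝ] ℝ) (ν : W) (hα : ∀ v, α (L v) = 0) (hν : α ν = 1)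
    (hdim : Module.finrank ℝ W = Module.finrank ℝ V + 1) (a : W) : ∃ v, a = L v + α a • ν := by
  -- T is injective since α isolates the coefficient of ν; the dimension hypothesis then makes it
  -- surjective.
  let T : V × ℝ →ₗ[ℝ] W := L.coprod (LinearMap.toSpanSingleton ℝ W ν)
  have hT : ∀ p : V × ℝ, T p = L p.1 + p.2 • ν := fun p => by simp [T]
  have hinj : Function.Injective T := by
    rw [injective_iff_map_eq_zero]
    rintro ⟨v, t⟩ h
    rw [hT] at h
    have ht : t = 0 := by simpa [hα, hν] using congrArg α h
    have hv : v = 0 := hL (by simpa [ht] using h)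
    simp [ht, hv]
  have hsurj : Function.Surjective T :=
    (LinearMap.injective_iff_surjective_of_finrank_eq_finrank (by simp [hdim])).1 hinj
  obtain ⟨p, hp⟩ := hsurj a
  refine ⟨p.1, ?_⟩
  have ht : α a = p.2 := by rw [← hp, hT]; simp [hα, hν]
  rw [ht, ← hT, hp]

/-! ### Gauss equations on an immersed hypersurface, free of coordinates. -/

section Hypersurface

variable {E : Type*} [NormedAddCommGroup E] [NormedSpace ℝ E] [FiniteDimensional ℝ E]
  {H : Type*} [TopologicalSpace H] {I : ModelWithCorners ℝ E H}
  {M : Type*} [TopologicalSpace M] [ChartedSpace H M] [IsManifold I ∞ M] [I.Boundaryless]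
  {E' : Type*} [NormedAddCommGroup E'] [NormedSpace ℝ E'] [FiniteDimensional ℝ E']
  {H' : Type*} [TopologicalSpace H'] {J : ModelWithCorners ℝ E' H'}
  {N : Type*} [TopologicalSpace N] [ChartedSpace H' N] [IsManifold J ∞ N] [J.Boundaryless]

set_option linter.unusedSectionVars false

/-- An immersed hypersurface with a smooth unit normal field. -/
structure IsHypersurface (S : MagneticSystem I M) (J : ModelWithCorners ℝ E' H') (ι : N → M)
    (η : ∀ x : N, TangentSpace I (ι x)) : Prop where
  contMDiff : ContMDiff J I ∞ ι
  injective : ∀ x : N, Function.Injective (mfderiv J I ι x)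
  contMDiff_normal : ContMDiff J I.tangent ∞ (fun x : N => (⟨ι x, η x⟩ : TangentBundle I M))
  unit : ∀ x : N, S.g (ι x) (η x) (η x) = 1
  perp : ∀ (x : N) (w : TangentSpace J x), S.g (ι x) (mfderiv J I ι x w) (η x) = 0
  finrank_eq : Module.finrank ℝ E = Module.finrank ℝ E' + 1

variable {S : MagneticSystem I M} {ι : N → M} {η : ∀ x : N, TangentSpace I (ι x)}

section

variable (hH : IsHypersurface S J ι η)
include hH

lemma IsHypersurface.isPullbackAt (x : N) :
    IsPullbackAt (coordForm S.g (ι x)) (localRep J I ι x) (coordForm (S.inducedMetric J ι) x)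
      (extChartAt J x x) :=
  S.isPullbackAt hH.contMDiff hH.injective x

lemma IsHypersurface.toCoord_mfderiv (x : N) (w : TangentSpace J x) :
    toCoord (ι x) (mfderiv J I ι x w)
      = fderiv ℝ (localRep J I ι x) (extChartAt J x x) (toCoord x w) :=
  toCoordAt_mfderiv hH.contMDiff (mem_extChartAt_source x) (mem_extChartAt_source (ι x)) w

lemma IsHypersurface.isInvertible_g (x : M) : (S.g x).IsInvertible :=
  isInvertible_of_pos _ (S.pos x)

lemma IsHypersurface.isInvertible_inducedMetric (x : N) : (S.inducedMetric J ι x).IsInvertible :=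
  isInvertible_of_pos _ (S.inducedMetric_pos hH.injective x)

lemma IsHypersurface.inducedMetric_tangentPart (x : N) (z : TangentSpace I (ι x))
    (w : TangentSpace J x) :
    S.inducedMetric J ι x (tangentPart J S.g ι x z) w = S.g (ι x) z (mfderiv J I ι x w) := by
  simp only [tangentPart]
  rw [(hH.isInvertible_inducedMetric x).self_apply_inverse]
  rfl

/-- The dimension count supplies some tangential component; pairing with tangent vectors identifies
it as `tangentPart`. -/
lemma IsHypersurface.eq_tangentPart_add (x : N) (z : TangentSpace I (ι x)) :
    z = mfderiv J I ι x (tangentPart J S.g ι x z) + S.g (ι x) z (η x) • η x := by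
  obtain ⟨v, hv⟩ := exists_eq_add_smul (mfderiv J I ι x : TangentSpace J x →ₗ[ℝ] _)
    (hH.injective x) (S.g (ι x) (η x) : TangentSpace I (ι x) →ₗ[ℝ] ℝ) (η x)
    (fun v => (S.symm _ _ _).trans (hH.perp x v)) (hH.unit x) hH.finrank_eq z
  have hv' : z = mfderiv J I ι x v + S.g (ι x) z (η x) • η x := by
    rw [S.symm]; exact hv
  have ht : tangentPart J S.g ι x z = v := by
    apply (hH.isInvertible_inducedMetric x).injective
    ext w
    rw [hH.inducedMetric_tangentPart, hv', map_add, map_smul, add_apply, smul_apply,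
      S.symm (ι x) (η x), hH.perp]
    simp [pullbackForm]
  rwa [ht]

/-- The coordinate expression of the unit normal field. -/
lemma IsHypersurface.isUnitNormalAt (x : N) :
    IsUnitNormalAt (coordForm S.g (ι x)) (localRep J I ι x)
      (coordAlong ι η x ∘ (extChartAt J x).symm) (extChartAt J x x) := by
  have hν : (coordAlong ι η x ∘ (extChartAt J x).symm) (extChartAt J x x)
      = toCoord (ι x) (η x) := by
    rw [Function.comp_apply, extChartAt_to_inv]; rfl
  have hF : localRep J I ι x (extChartAt J x x) = extChartAt I (ι x) (ι x) :=
    localRep_extChartAt ι (mem_extChartAt_source x)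
  refine ⟨differentiableAt_coordAlong hH.contMDiff_normal x, ?_, ?_, ?_⟩
  · filter_upwards [eventually_mem_chart (I := I) hH.contMDiff x] with y hy a
    exact (coordForm_mfderiv_coordAlong hH.contMDiff hy.1 hy.2 S.g η a).trans (hH.perp _ _)
  · rw [hν, hF, coordForm_toCoord, hH.unit]
  · intro a ha ha'
    rw [hν, hF, ← toCoord_ofCoord (I := I) (ι x) a, coordForm_toCoord] at ha'
    have hzero : (ofCoord (ι x) a : TangentSpace I (ι x)) = 0 := by
      rw [hH.eq_tangentPart_add x (ofCoord (ι x) a), ha', zero_smul, add_zero]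
      suffices tangentPart J S.g ι x (ofCoord (ι x) a) = 0 by rw [this, map_zero]
      apply (hH.isInvertible_inducedMetric x).injective
      ext w
      rw [hH.inducedMetric_tangentPart, ← coordForm_toCoord, toCoord_ofCoord,
        hH.toCoord_mfderiv, ← hF, ha, map_zero]
      rfl
    rw [← toCoord_ofCoord (I := I) (ι x) a, hzero, map_zero]

/-- `covDerivAlong` is computed in the same chart of M as `coordCovAlong`, so the two covariant
derivatives of the normal field correspond. -/
lemma IsHypersurface.coordSecondForm_eq (x : N) (v w : TangentSpace J x) :
    coordSecondForm (coordForm S.g (ι x)) (localRep J I ι x)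
        (coordAlong ι η x ∘ (extChartAt J x).symm) (extChartAt J x x) (toCoord x v) (toCoord x w)
      = S.inducedMetric J ι x (shapeOperator S.g ι η x v) w := by
  have hF : localRep J I ι x (extChartAt J x x) = extChartAt I (ι x) (ι x) :=
    localRep_extChartAt ι (mem_extChartAt_source x)
  have hν : (coordAlong ι η x ∘ (extChartAt J x).symm) (extChartAt J x x)
      = toCoord (ι x) (η x) := by
    rw [Function.comp_apply, extChartAt_to_inv]; rfl
  have hd := mvfderiv_eq_fderiv_coord (mem_extChartAt_source x)
    ((contMDiffAt_coordAlong hH.contMDiff_normal x).mdifferentiableAt (by simp)) v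
  have hcov : coordCovAlong (coordForm S.g (ι x)) (localRep J I ι x)
      (coordAlong ι η x ∘ (extChartAt J x).symm) (extChartAt J x x) (toCoord x v)
      = toCoord (ι x) (covDerivAlong S.g ι η x v) := by
    rw [covDerivAlong, toCoord_ofCoord, coordCovAlong, hν, hF, ← hH.toCoord_mfderiv, hd]
    rfl
  have hS : shapeOperator S.g ι η x v = -tangentPart J S.g ι x (covDerivAlong S.g ι η x v) := rfl
  rw [coordSecondForm, hcov, hS, map_neg, neg_apply, hH.inducedMetric_tangentPart, hF,
    ← hH.toCoord_mfderiv, coordForm_toCoord]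

lemma IsHypersurface.shapeOperator_symm (x : N) (v w : TangentSpace J x) :
    S.inducedMetric J ι x (shapeOperator S.g ι η x v) w
      = S.inducedMetric J ι x (shapeOperator S.g ι η x w) v := by
  rw [← hH.coordSecondForm_eq, ← hH.coordSecondForm_eq,
    (hH.isPullbackAt x).coordSecondForm_comm (hH.isUnitNormalAt x)]

/-- The Gauss equation. -/
lemma IsHypersurface.curvature_eq (x : N) (u v z w : TangentSpace J x) :
    S.inducedMetric J ι x (curvature (S.inducedMetric J ι) x u v z) w
      = S.g (ι x) (curvature S.g (ι x) (mfderiv J I ι x u) (mfderiv J I ι x v)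
            (mfderiv J I ι x z)) (mfderiv J I ι x w)
        + S.inducedMetric J ι x (shapeOperator S.g ι η x v) z
            * S.inducedMetric J ι x (shapeOperator S.g ι η x u) w
        - S.inducedMetric J ι x (shapeOperator S.g ι η x u) z
            * S.inducedMetric J ι x (shapeOperator S.g ι η x v) w := by
  have hF : localRep J I ι x (extChartAt J x x) = extChartAt I (ι x) (ι x) :=
    localRep_extChartAt ι (mem_extChartAt_source x)
  have h := (hH.isPullbackAt x).gauss_equation (hH.isUnitNormalAt x) (toCoord x u) (toCoord x v)
    (toCoord x z) (toCoord x w)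
  rw [hH.coordSecondForm_eq, hH.coordSecondForm_eq, hH.coordSecondForm_eq, hH.coordSecondForm_eq,
    hF, ← hH.toCoord_mfderiv, ← hH.toCoord_mfderiv, ← hH.toCoord_mfderiv,
    ← hH.toCoord_mfderiv] at h
  rw [← coordForm_toCoord (S.inducedMetric J ι) x (curvature (S.inducedMetric J ι) x u v z) w,
    ← coordForm_toCoord S.g (ι x) (curvature S.g (ι x) _ _ _), curvature, curvature,
    toCoord_ofCoord, toCoord_ofCoord]
  exact h

/-- Both sides equal σ(dι v, dι w): the induced Lorentz force is the tangential part of the ambient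
one. -/
lemma IsHypersurface.inducedMetric_lorentzForce (x : N) (v w : TangentSpace J x) :
    S.inducedMetric J ι x (lorentzForce (S.inducedMetric J ι) (S.inducedForm J ι) x v) w
      = S.g (ι x) (lorentzForce S.g S.form (ι x) (mfderiv J I ι x v)) (mfderiv J I ι x w) := by
  rw [apply_lorentzForce (hH.isInvertible_inducedMetric x), apply_lorentzForce (hH.isInvertible_g _)]
  rfl

lemma IsHypersurface.covDerivEnd_eq (x : N) (w v z : TangentSpace J x) :
    S.inducedMetric J ι x (covDerivEnd (S.inducedMetric J ι)
        (lorentzForce (S.inducedMetric J ι) (S.inducedForm J ι)) x w v) z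
      = S.g (ι x) (covDerivEnd S.g (lorentzForce S.g S.form) (ι x) (mfderiv J I ι x w)
            (mfderiv J I ι x v)) (mfderiv J I ι x z)
        + S.inducedMetric J ι x (shapeOperator S.g ι η x w) v
            * S.g (ι x) (lorentzForce S.g S.form (ι x) (η x)) (mfderiv J I ι x z)
        + S.inducedMetric J ι x (shapeOperator S.g ι η x w) z
            * S.g (ι x) (lorentzForce S.g S.form (ι x) (mfderiv J I ι x v)) (η x) := by
  have hF : localRep J I ι x (extChartAt J x x) = extChartAt I (ι x) (ι x) :=
    localRep_extChartAt ι (mem_extChartAt_source x)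
  have hν : (coordAlong ι η x ∘ (extChartAt J x).symm) (extChartAt J x x)
      = toCoord (ι x) (η x) := by
    rw [Function.comp_apply, extChartAt_to_inv]; rfl
  have htx := mem_extChartAt_target (I := I) (ι x)
  have hG := hH.isPullbackAt x
  have hA : DifferentiableAt ℝ (coordEnd (lorentzForce S.g S.form) (ι x))
      (localRep J I ι x (extChartAt J x x)) := by
    refine differentiableAt_coordEnd_lorentzForce S.symm S.pos (by rw [hF]; exact htx)
      hG.metric.contDiffAt ?_
    rw [hF]
    exact ((contDiffOn_coordForm S.form_contMDiff (ι x)).contDiffAt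
      ((isOpen_extChartAt_target (ι x)).mem_nhds htx)).differentiableAt (by simp)
  have hB : DifferentiableAt ℝ (coordEnd (lorentzForce (S.inducedMetric J ι) (S.inducedForm J ι)) x)
      (extChartAt J x x) :=
    differentiableAt_coordEnd_lorentzForce S.inducedMetric_symm
      (S.inducedMetric_pos hH.injective) (mem_extChartAt_target x) hG.pullback.contDiffAt
      ((contDiffAt_coordForm_pullbackForm hH.contMDiff S.form_contMDiff x).differentiableAt
        (by norm_num))
  have hAB : ∀ᶠ p in 𝓝 (extChartAt J x x), ∀ a b,
      coordForm (S.inducedMetric J ι) x p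
          (coordEnd (lorentzForce (S.inducedMetric J ι) (S.inducedForm J ι)) x p a) b
        = coordForm S.g (ι x) (localRep J I ι x p)
            (coordEnd (lorentzForce S.g S.form) (ι x) (localRep J I ι x p)
              (fderiv ℝ (localRep J I ι x) p a)) (fderiv ℝ (localRep J I ι x) p b) := by
    filter_upwards [eventually_mem_chart (I := I) hH.contMDiff x] with p hp a b
    have hp' : localRep J I ι x p ∈ (extChartAt I (ι x)).target :=
      (extChartAt I (ι x)).map_source hp.2
    rw [coordForm_coordEnd_lorentzForce _ hp.1 (hH.isInvertible_inducedMetric _),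
      coordForm_coordEnd_lorentzForce _ hp' (hH.isInvertible_g _),
      coordForm_pullbackForm hH.contMDiff hp.1 hp.2]
  have h := hG.covDerivEnd_equation (hH.isUnitNormalAt x) hA hB hAB (toCoord x w) (toCoord x v)
    (toCoord x z)
  have hend : ∀ a : TangentSpace I (ι x), coordEnd (lorentzForce S.g S.form) (ι x)
      (extChartAt I (ι x) (ι x)) (toCoord (ι x) a)
      = toCoord (ι x) (lorentzForce S.g S.form (ι x) a) := fun a =>
    (toCoordAt_apply_end (lorentzForce S.g S.form) (mem_extChartAt_source (ι x)) a).symm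
  rw [hH.coordSecondForm_eq, hH.coordSecondForm_eq, hν, hF, ← hH.toCoord_mfderiv,
    ← hH.toCoord_mfderiv, ← hH.toCoord_mfderiv, hend, hend, coordForm_toCoord,
    coordForm_toCoord] at h
  rw [← coordForm_toCoord (S.inducedMetric J ι) x (covDerivEnd _ _ x w v) z,
    ← coordForm_toCoord S.g (ι x) (covDerivEnd S.g _ (ι x) _ _), covDerivEnd, covDerivEnd,
    toCoord_ofCoord, toCoord_ofCoord]
  exact h

end

end Hypersurface

/-! ### The magnetic Gauss equation and sectional curvature. -/

section MagneticHypersurface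

variable {E : Type*} [NormedAddCommGroup E] [NormedSpace ℝ E] [FiniteDimensional ℝ E]
  {H : Type*} [TopologicalSpace H] {I : ModelWithCorners ℝ E H}
  {M : Type*} [TopologicalSpace M] [ChartedSpace H M] [IsManifold I ∞ M] [I.Boundaryless]
  {E' : Type*} [NormedAddCommGroup E'] [NormedSpace ℝ E'] [FiniteDimensional ℝ E']
  {H' : Type*} [TopologicalSpace H'] {J : ModelWithCorners ℝ E' H'}
  {N : Type*} [TopologicalSpace N] [ChartedSpace H' N] [IsManifold J ∞ N] [J.Boundaryless]

set_option linter.unusedSectionVars false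

lemma apply_projPerp (g : BilinField I M) (x : M) (v a z : TangentSpace I x) :
    g x (projPerp g x v a) z = g x a z - g x v a * g x v z := by
  simp [projPerp, projLine]

lemma apply_magneticCurvature (g σ : BilinField I M) (s : ℝ) (x : M) (v w z : TangentSpace I x) :
    g x (magneticCurvature g σ s x v w) z
      = s ^ 2 * g x (curvature g x w v v) z
        - s * g x (covDerivEnd g (lorentzForce g σ) x w v) z
        + s / 2 * (g x (covDerivEnd g (lorentzForce g σ) x v w) z
            - g x v (covDerivEnd g (lorentzForce g σ) x v w) * g x v z)
        - 3 / 4 * (g x v (lorentzForce g σ x w) * g x (lorentzForce g σ x v) z)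
        - 1 / 4 * (g x (lorentzForce g σ x (lorentzForce g σ x w)) z
            - g x v (lorentzForce g σ x (lorentzForce g σ x w)) * g x v z) := by
  have hR : magneticR g σ s x v w = s ^ 2 • curvature g x w v v
      - s • covDerivEnd g (lorentzForce g σ) x w v
      + (s / 2) • projPerp g x v (covDerivEnd g (lorentzForce g σ) x v w) := rfl
  have hA : magneticA g σ x v w
      = -(3 / 4 : ℝ) • lorentzForce g σ x (projLine g x v (lorentzForce g σ x w))
        - (1 / 4 : ℝ) • projPerp g x v (lorentzForce g σ x (lorentzForce g σ x w)) := rfl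
  have hl : projLine g x v (lorentzForce g σ x w) = g x v (lorentzForce g σ x w) • v := rfl
  rw [magneticCurvature, LinearMap.add_apply, hR, hA, hl]
  simp only [map_add, map_sub, map_smul, add_apply, sub_apply, smul_apply, smul_eq_mul,
    apply_projPerp]
  ring

lemma MagneticSystem.form_swap (S : MagneticSystem I M) (x : M) (v w : TangentSpace I x) :
    S.form x v w = -S.form x w v := by
  have h := S.form_self x (v + w)
  simp only [map_add, add_apply, S.form_self] at h
  linarith

variable {S : MagneticSystem I M} {ι : N → M} {η : ∀ x : N, TangentSpace I (ι x)}
  (hH : IsHypersurface S J ι η)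
include hH

lemma IsHypersurface.thetaForm_eq (x : N) (w : TangentSpace J x) :
    thetaForm S.g S.form ι η x w
      = S.g (ι x) (lorentzForce S.g S.form (ι x) (mfderiv J I ι x w)) (η x) := by
  have h : thetaForm S.g S.form ι η x w
      = S.g (ι x) (normalLorentzForce S.g S.form ι x w) (η x) := rfl
  rw [h, normalLorentzForce, normalPart, map_sub, sub_apply, hH.perp, sub_zero]

lemma IsHypersurface.apply_lorentzForce_normal (x : N) (z : TangentSpace J x) :
    S.g (ι x) (lorentzForce S.g S.form (ι x) (η x)) (mfderiv J I ι x z)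
      = -thetaForm S.g S.form ι η x z := by
  rw [hH.thetaForm_eq, apply_lorentzForce (hH.isInvertible_g _),
    apply_lorentzForce (hH.isInvertible_g _), S.form_swap]

/-- The vector dual to the form `θ` is minus the tangential part of the Lorentz force of the
unit normal. -/
lemma IsHypersurface.inducedMetric_tangentPart_lorentzForce (x : N) (z : TangentSpace J x) :
    S.inducedMetric J ι x (tangentPart J S.g ι x (lorentzForce S.g S.form (ι x) (η x))) z
      = -thetaForm S.g S.form ι η x z := by
  rw [hH.inducedMetric_tangentPart, hH.apply_lorentzForce_normal]

lemma IsHypersurface.inducedMetric_magneticShapeOperator (s : ℝ) (x : N)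
    (v z : TangentSpace J x) :
    S.inducedMetric J ι x (magneticShapeOperator S.g S.form ι s x v η) z
      = s ^ 2 * S.inducedMetric J ι x (shapeOperator S.g ι η x v) z
        - s * thetaForm S.g S.form ι η x z := by
  rw [magneticShapeOperator, map_add, map_smul, map_smul, add_apply, smul_apply, smul_apply,
    hH.inducedMetric_tangentPart_lorentzForce]
  simp only [smul_eq_mul]
  ring

/-- Apply 𝒴 to 𝒴 dι w = dι(𝒴^N w) + θ(w)η; the normal part contributes θ(w) g(𝒴η, dι z) = -θ(w)θ(z).
-/
lemma IsHypersurface.inducedMetric_lorentzForce_sq (x : N) (w z : TangentSpace J x) :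
    S.inducedMetric J ι x (lorentzForce (S.inducedMetric J ι) (S.inducedForm J ι) x
        (lorentzForce (S.inducedMetric J ι) (S.inducedForm J ι) x w)) z
      = S.g (ι x) (lorentzForce S.g S.form (ι x)
          (lorentzForce S.g S.form (ι x) (mfderiv J I ι x w))) (mfderiv J I ι x z)
        + thetaForm S.g S.form ι η x w * thetaForm S.g S.form ι η x z := by
  have ht : tangentPart J S.g ι x (lorentzForce S.g S.form (ι x) (mfderiv J I ι x w))
      = lorentzForce (S.inducedMetric J ι) (S.inducedForm J ι) x w := by
    apply (hH.isInvertible_inducedMetric x).injective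
    ext z
    rw [hH.inducedMetric_tangentPart, hH.inducedMetric_lorentzForce]
  rw [hH.inducedMetric_lorentzForce]
  conv_rhs => rw [hH.eq_tangentPart_add x (lorentzForce S.g S.form (ι x) (mfderiv J I ι x w)), ht,
    ← hH.thetaForm_eq]
  rw [map_add, map_smul, map_add, map_smul, add_apply, smul_apply, hH.apply_lorentzForce_normal]
  simp only [smul_eq_mul]
  ring

/-- The magnetic Gauss equation, in its polarized form. -/
lemma IsHypersurface.inducedMetric_magneticCurvature (s : ℝ) (x : N) (v w z : TangentSpace J x) :
    S.inducedMetric J ι x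
        (magneticCurvature (S.inducedMetric J ι) (S.inducedForm J ι) s x v w) z
      = S.g (ι x) (magneticCurvature S.g S.form s (ι x) (mfderiv J I ι x v) (mfderiv J I ι x w))
          (mfderiv J I ι x z)
        + s ^ 2 * (S.inducedMetric J ι x (shapeOperator S.g ι η x v) v
              * S.inducedMetric J ι x (shapeOperator S.g ι η x w) z
            - S.inducedMetric J ι x (shapeOperator S.g ι η x v) w
              * S.inducedMetric J ι x (shapeOperator S.g ι η x v) z)
        - s * (thetaForm S.g S.form ι η x v * S.inducedMetric J ι x (shapeOperator S.g ι η x w) z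
            - S.inducedMetric J ι x (shapeOperator S.g ι η x v) w * thetaForm S.g S.form ι η x z)
        + s / 2 * (thetaForm S.g S.form ι η x w
              * S.inducedMetric J ι x (projPerp (S.inducedMetric J ι) x v
                  (shapeOperator S.g ι η x v)) z
            - S.inducedMetric J ι x (shapeOperator S.g ι η x v) w
              * (thetaForm S.g S.form ι η x z
                - S.inducedMetric J ι x v z * thetaForm S.g S.form ι η x v))
        - 1 / 4 * (thetaForm S.g S.form ι η x w * (thetaForm S.g S.form ι η x z
                - S.inducedMetric J ι x v z * thetaForm S.g S.form ι η x v)) := by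
  have hg : ∀ a b : TangentSpace J x, S.g (ι x) (mfderiv J I ι x a) (mfderiv J I ι x b)
      = S.inducedMetric J ι x a b := fun a b => rfl
  have hsw : ∀ a : TangentSpace J x, S.inducedMetric J ι x v a = S.inducedMetric J ι x a v :=
    fun a => S.inducedMetric_symm x v a
  -- Pairings g(v, ·) are flipped so that the tangent vector stands second, as the comparison lemmas
  -- require.
  rw [apply_magneticCurvature, apply_magneticCurvature, apply_projPerp, hg,
    hsw (covDerivEnd _ _ x v w), hsw (lorentzForce _ _ x w), hsw (lorentzForce _ _ x _),
    hsw (shapeOperator S.g ι η x v),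
    S.symm (ι x) (mfderiv J I ι x v) (covDerivEnd _ _ _ _ _),
    S.symm (ι x) (mfderiv J I ι x v) (lorentzForce _ _ _ (mfderiv J I ι x w)),
    S.symm (ι x) (mfderiv J I ι x v) (lorentzForce _ _ _ (lorentzForce _ _ _ _)),
    hH.curvature_eq, hH.covDerivEnd_eq, hH.covDerivEnd_eq, hH.covDerivEnd_eq,
    hH.inducedMetric_lorentzForce, hH.inducedMetric_lorentzForce,
    hH.inducedMetric_lorentzForce_sq, hH.inducedMetric_lorentzForce_sq,
    hH.apply_lorentzForce_normal, hH.apply_lorentzForce_normal, ← hH.thetaForm_eq,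
    ← hH.thetaForm_eq, hH.shapeOperator_symm x w v]
  ring

/-- The Gauss equation for the magnetic sectional curvature. -/
theorem IsHypersurface.magneticSec_eq (s : ℝ) (x : N) (v w : TangentSpace J x)
    (hvw : S.inducedMetric J ι x v w = 0) :
    magneticSec (S.inducedMetric J ι) (S.inducedForm J ι) s x v w
      = magneticSec S.g S.form s (ι x) (mfderiv J I ι x v) (mfderiv J I ι x w)
        + Matrix.det
            !![S.inducedMetric J ι x (magneticShapeOperator S.g S.form ι s x v η) v,
                S.inducedMetric J ι x (shapeOperator S.g ι η x v) w;
              S.inducedMetric J ι x (magneticShapeOperator S.g S.form ι s x v η) w,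
                S.inducedMetric J ι x (shapeOperator S.g ι η x w) w]
        - 1 / 4 * thetaForm S.g S.form ι η x w ^ 2 := by
  -- With z = w orthogonal to v, the two s/2 terms are ±θ(w) g(S_η v, w) and cancel.
  rw [magneticSec, magneticSec, hH.inducedMetric_magneticCurvature, Matrix.det_fin_two_of,
    hH.inducedMetric_magneticShapeOperator, hH.inducedMetric_magneticShapeOperator,
    apply_projPerp, hvw]
  ring

end MagneticHypersurface

/-! ### Traces and the magnetic Ricci curvature. -/

section MagneticHypersurface

variable {E : Type*} [NormedAddCommGroup E] [NormedSpace ℝ E] [FiniteDimensional ℝ E]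
  {H : Type*} [TopologicalSpace H] {I : ModelWithCorners ℝ E H}
  {M : Type*} [TopologicalSpace M] [ChartedSpace H M] [IsManifold I ∞ M] [I.Boundaryless]
  {E' : Type*} [NormedAddCommGroup E'] [NormedSpace ℝ E'] [FiniteDimensional ℝ E']
  {H' : Type*} [TopologicalSpace H'] {J : ModelWithCorners ℝ E' H'}
  {N : Type*} [TopologicalSpace N] [ChartedSpace H' N] [IsManifold J ∞ N] [J.Boundaryless]

set_option linter.unusedSectionVars false

/-- The trace of the compression of an operator to `v^⊥`. -/
lemma trace_projToPerp_comp (g : BilinField I M) (x : M) (v : TangentSpace I x)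
    (hv : g x v v = 1) (T : TangentSpace I x →ₗ[ℝ] TangentSpace I x) :
    LinearMap.trace ℝ (perp g x v) (projToPerp g x v hv ∘ₗ T ∘ₗ (perp g x v).subtype)
      = LinearMap.trace ℝ (TangentSpace I x) T - g x v (T v) := by
  -- Cyclicity of the trace replaces the compression by T composed with P_{v^⊥} = id - P_v on the
  -- whole space.
  rw [LinearMap.trace_comp_comm', LinearMap.comp_assoc]
  have h : (perp g x v).subtype ∘ₗ projToPerp g x v hv = projPerp g x v := by
    ext w; rfl
  rw [h, projPerp, LinearMap.comp_sub, LinearMap.comp_id, map_sub]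
  have h2 : T ∘ₗ projLine g x v
      = ((g x v : TangentSpace I x →L[ℝ] ℝ) : TangentSpace I x →ₗ[ℝ] ℝ).smulRight (T v) := by
    ext w
    simp [projLine]
  rw [h2, LinearMap.trace_smulRight]
  rfl

lemma magneticRic_eq_trace (g σ : BilinField I M) (s : ℝ) (x : M) (v : TangentSpace I x)
    (hv : g x v v = 1) :
    magneticRic g σ s x v hv
      = LinearMap.trace ℝ (TangentSpace I x) (magneticCurvature g σ s x v)
        - g x v (magneticCurvature g σ s x v v) :=
  trace_projToPerp_comp g x v hv _

/-- The norm on `v^⊥` of the functional represented by `p`. -/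
lemma normOnPerp_sq {g : BilinField I M} {x : M} (hsymm : ∀ a b, g x a b = g x b a)
    (hpos : ∀ a, a ≠ 0 → 0 < g x a a) (v : TangentSpace I x) (hv : g x v v = 1)
    (α : TangentSpace I x →ₗ[ℝ] ℝ) (p : TangentSpace I x) (hα : ∀ z, g x p z = α z) :
    normOnPerp g x v α ^ 2 = α p - α v ^ 2 := by
  have hnonneg : ∀ a, 0 ≤ g x a a := fun a => by
    rcases eq_or_ne a 0 with rfl | ha
    · simp
    · exact (hpos a ha).le
  -- q represents α on v^⊥, so the supremum is |q|, attained at q/|q|. If q = 0 the convention 0⁻¹ =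
  -- 0 gives the witness 0.
  obtain ⟨q, hq⟩ : ∃ q, q = projPerp g x v p := ⟨_, rfl⟩
  have hqz : ∀ z, g x q z = α z - α v * g x v z := fun z => by
    rw [hq, apply_projPerp, hα, hsymm v p, hα]
  have hqv : g x v q = 0 := by rw [hsymm, hqz, hv]; ring
  have hqq : g x q q = α q := by rw [hqz, hqv]; ring
  have hqp : α q = α p - α v ^ 2 := by
    rw [← hα, hsymm, hqz, hsymm v p, hα]; ring
  have hgreat : IsGreatest ((fun w => |α w|) '' {w | w ∈ perp g x v ∧ g x w w ≤ 1})
      (√(g x q q)) := by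
    constructor
    · refine ⟨(√(g x q q))⁻¹ • q, ⟨?_, ?_⟩, ?_⟩
      · simp [perp, hqv]
      · simp only [map_smul, smul_apply, smul_eq_mul]
        have : (√(g x q q))⁻¹ * ((√(g x q q))⁻¹ * g x q q) = g x q q / g x q q := by
          rw [← mul_assoc, ← mul_inv, Real.mul_self_sqrt (hnonneg q), div_eq_inv_mul]
        rw [this]
        exact div_self_le_one _
      · simp only [map_smul, smul_eq_mul, ← hqq]
        rw [← div_eq_inv_mul, Real.div_sqrt, abs_of_nonneg (Real.sqrt_nonneg _)]
    · rintro _ ⟨w, ⟨hw, hw1⟩, rfl⟩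
      have hw0 : g x v w = 0 := by simpa [perp] using hw
      have hαw : α w = g x q w := by rw [hqz, hw0]; ring
      apply Real.abs_le_sqrt
      -- Cauchy–Schwarz: this square expands to g(q,q)(g(q,q)g(w,w) - g(q,w)²).
      have hcs : 0 ≤ g x (g x q q • w - g x q w • q) (g x q q • w - g x q w • q) := hnonneg _
      simp only [map_sub, map_smul, sub_apply, smul_apply, smul_eq_mul, hsymm w q] at hcs
      rcases (hnonneg q).eq_or_lt with h0 | h0
      · have : q = 0 := by
          by_contra hne
          exact absurd (hpos q hne) (by rw [← h0]; exact lt_irrefl 0)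
        simp [hαw, this]
      · have h1 : 0 ≤ g x q q * (g x q q * g x w w - g x q w ^ 2) := by nlinarith
        have h2 := nonneg_of_mul_nonneg_right h1 h0
        rw [hαw]
        nlinarith
  rw [normOnPerp, hgreat.csSup_eq, Real.sq_sqrt (hnonneg q), hqq, hqp]

variable {S : MagneticSystem I M} {ι : N → M} {η : ∀ x : N, TangentSpace I (ι x)}

/-- The tangential part as a linear map. -/
def tangentMap (S : MagneticSystem I M) (J : ModelWithCorners ℝ E' H') (ι : N → M) (x : N) :
    TangentSpace I (ι x) →ₗ[ℝ] TangentSpace J x where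
  toFun z := tangentPart J S.g ι x z
  map_add' z z' := by
    simp only [tangentPart, map_add, ContinuousLinearMap.add_comp]
  map_smul' c z := by
    simp only [tangentPart, map_smul, ContinuousLinearMap.smul_comp, RingHom.id_apply]

variable (hH : IsHypersurface S J ι η)
include hH

/-- The trace of an ambient operator splits into a tangential and a normal part. -/
lemma IsHypersurface.trace_eq (x : N) (T : TangentSpace I (ι x) →ₗ[ℝ] TangentSpace I (ι x)) :
    LinearMap.trace ℝ (TangentSpace I (ι x)) T
      = LinearMap.trace ℝ (TangentSpace J x)
          (tangentMap S J ι x ∘ₗ T ∘ₗ (mfderiv J I ι x : TangentSpace J x →ₗ[ℝ] _))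
        + S.g (ι x) (T (η x)) (η x) := by
  -- This is T composed with the decomposition of the identity into tangential and normal
  -- projections.
  have hid : T = (T ∘ₗ (mfderiv J I ι x : TangentSpace J x →ₗ[ℝ] _)) ∘ₗ tangentMap S J ι x
      + ((S.g (ι x) (η x) : TangentSpace I (ι x) →L[ℝ] ℝ) :
          TangentSpace I (ι x) →ₗ[ℝ] ℝ).smulRight (T (η x)) := by
    ext z
    conv_lhs => rw [hH.eq_tangentPart_add x z, map_add, map_smul, S.symm]
    rfl
  conv_lhs => rw [hid, map_add, LinearMap.trace_comp_comm', LinearMap.trace_smulRight]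
  rw [S.symm]
  rfl

/-- The operator form of the magnetic Gauss equation, traced. -/
lemma IsHypersurface.trace_magneticCurvature (s : ℝ) (x : N) (v : TangentSpace J x)
    (hv : S.inducedMetric J ι x v v = 1) :
    LinearMap.trace ℝ (TangentSpace J x)
        (magneticCurvature (S.inducedMetric J ι) (S.inducedForm J ι) s x v)
      = LinearMap.trace ℝ (TangentSpace J x) (tangentMap S J ι x
          ∘ₗ magneticCurvature S.g S.form s (ι x) (mfderiv J I ι x v)
          ∘ₗ (mfderiv J I ι x : TangentSpace J x →ₗ[ℝ] _))
        + LinearMap.trace ℝ (TangentSpace J x) (shapeOperator S.g ι η x)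
            * S.inducedMetric J ι x (magneticShapeOperator S.g S.form ι s x v η) v
        - S.inducedMetric J ι x (magneticShapeOperator S.g S.form ι s x v η)
            (shapeOperator S.g ι η x v)
        - 1 / 4 * normOnPerp (S.inducedMetric J ι) x v (thetaForm S.g S.form ι η x) ^ 2 := by
  obtain ⟨t, ht⟩ : ∃ t : TangentSpace J x, ∀ z, S.inducedMetric J ι x t z = thetaForm S.g S.form ι η x z :=
    ⟨-tangentPart J S.g ι x (lorentzForce S.g S.form (ι x) (η x)), fun z => by
      rw [map_neg, neg_apply, hH.inducedMetric_tangentPart_lorentzForce, neg_neg]⟩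
  have hsymm : ∀ a b, S.inducedMetric J ι x a b = S.inducedMetric J ι x b a :=
    S.inducedMetric_symm x
  let b : TangentSpace J x →ₗ[ℝ] ℝ :=
    ((S.inducedMetric J ι x (shapeOperator S.g ι η x v) : TangentSpace J x →L[ℝ] ℝ) :
      TangentSpace J x →ₗ[ℝ] ℝ)
  let θ : TangentSpace J x →ₗ[ℝ] ℝ := thetaForm S.g S.form ι η x
  let A : TangentSpace J x →ₗ[ℝ] TangentSpace J x := shapeOperator S.g ι η x
  let c := S.inducedMetric J ι x (A v) v
  -- t is the vector dual to θ, and q its projection to v^⊥.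
  let q := t - θ v • v
  -- The polarized identity as an equality of operators: every correction is a multiple of A or has
  -- rank-one summands, whose traces are evaluations.
  have hD : magneticCurvature (S.inducedMetric J ι) (S.inducedForm J ι) s x v
      = tangentMap S J ι x ∘ₗ magneticCurvature S.g S.form s (ι x) (mfderiv J I ι x v)
          ∘ₗ (mfderiv J I ι x : TangentSpace J x →ₗ[ℝ] _)
        + (s ^ 2 * c - s * θ v) • A - s ^ 2 • b.smulRight (A v) + s • b.smulRight t
        + (s / 2) • (θ.smulRight (projPerp (S.inducedMetric J ι) x v (A v)) - b.smulRight q)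
        - (1 / 4 : ℝ) • θ.smulRight q := by
    refine LinearMap.ext fun w => (hH.isInvertible_inducedMetric x).injective ?_
    ext z
    rw [hH.inducedMetric_magneticCurvature]
    have hm : S.inducedMetric J ι x (tangentMap S J ι x
        (magneticCurvature S.g S.form s (ι x) (mfderiv J I ι x v) (mfderiv J I ι x w))) z
        = S.g (ι x) (magneticCurvature S.g S.form s (ι x) (mfderiv J I ι x v)
            (mfderiv J I ι x w)) (mfderiv J I ι x z) := hH.inducedMetric_tangentPart x _ z
    simp only [LinearMap.add_apply, LinearMap.sub_apply, LinearMap.smul_apply,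
      LinearMap.comp_apply, LinearMap.smulRight_apply, map_add, map_sub, map_smul,
      add_apply, sub_apply, smul_apply, smul_eq_mul, q, ContinuousLinearMap.coe_coe, ht, b]
    rw [hm]
    simp only [θ, A, c]
    ring
  rw [hD, normOnPerp_sq hsymm (S.inducedMetric_pos hH.injective x) v hv _ t ht]
  simp only [map_add, map_sub, map_smul, LinearMap.trace_smulRight, smul_eq_mul]
  rw [hH.inducedMetric_magneticShapeOperator, hH.inducedMetric_magneticShapeOperator]
  have hbt : b t = θ (A v) := by
    have h : b t = S.inducedMetric J ι x (A v) t := rfl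
    rw [h, hsymm, ht]
  have hbv : b v = c := rfl
  have hbA : b (A v) = S.inducedMetric J ι x (A v) (A v) := rfl
  have hq : b q = b t - θ v * b v := by simp [q]
  have hθq : θ q = θ t - θ v ^ 2 := by simp [q]; ring
  have hP : θ (projPerp (S.inducedMetric J ι) x v (A v)) = θ (A v) - θ v * c := by
    rw [← ht, hsymm, apply_projPerp, hsymm (A v) t, ht, hsymm v t, ht, hsymm v (A v)]
    ring
  -- The s/2 part is traceless: θ(P_{v^⊥} A v) and b(q) both equal θ(A v) - θ(v)c.
  rw [hq, hθq, hP, hbt, hbv, hbA]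
  ring

/-- The Gauss equation for the magnetic Ricci curvature. -/
theorem IsHypersurface.magneticRic_eq (s : ℝ) (x : N) (v : TangentSpace J x)
    (hv : S.inducedMetric J ι x v v = 1)
    (hv' : S.g (ι x) (mfderiv J I ι x v) (mfderiv J I ι x v) = 1) :
    magneticRic (S.inducedMetric J ι) (S.inducedForm J ι) s x v hv
      = magneticRic S.g S.form s (ι x) (mfderiv J I ι x v) hv'
        - magneticSec S.g S.form s (ι x) (mfderiv J I ι x v) (η x)
        + LinearMap.trace ℝ (TangentSpace J x) (shapeOperator S.g ι η x)
            * S.inducedMetric J ι x (magneticShapeOperator S.g S.form ι s x v η) v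
        - S.inducedMetric J ι x (magneticShapeOperator S.g S.form ι s x v η)
            (shapeOperator S.g ι η x v)
        - 1 / 4 * normOnPerp (S.inducedMetric J ι) x v (thetaForm S.g S.form ι η x) ^ 2 := by
  -- For w = z = v all corrections in the polarized identity vanish, so the (v,v) entries removed
  -- from the two full traces coincide. The normal term of `trace_eq` is the sectional curvature of
  -- (v, η).
  rw [magneticRic_eq_trace, magneticRic_eq_trace, hH.trace_eq x, hH.trace_magneticCurvature s x v hv,
    magneticSec, S.inducedMetric_symm x v (magneticCurvature _ _ _ _ _ _), hH.inducedMetric_magneticCurvature,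
    S.symm (ι x) (mfderiv J I ι x v), apply_projPerp, S.inducedMetric_symm x v (shapeOperator _ _ _ _ _), hv]
  ring

end MagneticHypersurface

end MagneticGeometry

end

/-! ### The theorem for manifolds modelled on Euclidean spaces. -/

open MagneticGeometry in
theorem mainTheorem3 {n : ℕ}
    {M : Type*} [TopologicalSpace M] [ChartedSpace (EuclideanSpace ℝ (Fin (n + 1))) M]
    [IsManifold (𝓡 (n + 1)) ∞ M]
    {N : Type*} [TopologicalSpace N] [ChartedSpace (EuclideanSpace ℝ (Fin n)) N]
    [IsManifold (𝓡 n) ∞ N]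
    (S : MagneticSystem (𝓡 (n + 1)) M)
    (ι : N → M) (hι : ContMDiff (𝓡 n) (𝓡 (n + 1)) ∞ ι)
    (hι_inj : ∀ x : N, Function.Injective (mfderiv (𝓡 n) (𝓡 (n + 1)) ι x))
    (η : ∀ x : N, TangentSpace (𝓡 (n + 1)) (ι x))
    (hη : ContMDiff (𝓡 n) (𝓡 (n + 1)).tangent ∞
      (fun x : N => (⟨ι x, η x⟩ : TangentBundle (𝓡 (n + 1)) M)))
    (hη_unit : ∀ x : N, S.g (ι x) (η x) (η x) = 1)
    (hη_normal : ∀ (x : N) (w : TangentSpace (𝓡 n) x),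
      S.g (ι x) (mfderiv (𝓡 n) (𝓡 (n + 1)) ι x w) (η x) = 0)
    (s : ℝ) (hs : 0 < s) :
    (∀ (x : N) (v w : TangentSpace (𝓡 n) x), S.inducedMetric (𝓡 n) ι x v v = 1 →
        S.inducedMetric (𝓡 n) ι x w w = 1 → S.inducedMetric (𝓡 n) ι x v w = 0 →
      magneticSec (S.inducedMetric (𝓡 n) ι) (S.inducedForm (𝓡 n) ι) s x v w
        = magneticSec S.g S.form s (ι x) (mfderiv (𝓡 n) (𝓡 (n + 1)) ι x v)
            (mfderiv (𝓡 n) (𝓡 (n + 1)) ι x w)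
          + Matrix.det
              !![S.inducedMetric (𝓡 n) ι x (magneticShapeOperator S.g S.form ι s x v η) v,
                  S.inducedMetric (𝓡 n) ι x (shapeOperator S.g ι η x v) w;
                S.inducedMetric (𝓡 n) ι x (magneticShapeOperator S.g S.form ι s x v η) w,
                  S.inducedMetric (𝓡 n) ι x (shapeOperator S.g ι η x w) w]
          - 1 / 4 * thetaForm S.g S.form ι η x w ^ 2)
    ∧ (∀ (x : N) (v : TangentSpace (𝓡 n) x) (hv : S.inducedMetric (𝓡 n) ι x v v = 1),
      magneticRic (S.inducedMetric (𝓡 n) ι) (S.inducedForm (𝓡 n) ι) s x v hv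
        = magneticRic S.g S.form s (ι x) (mfderiv (𝓡 n) (𝓡 (n + 1)) ι x v) hv
          - magneticSec S.g S.form s (ι x) (mfderiv (𝓡 n) (𝓡 (n + 1)) ι x v) (η x)
          + LinearMap.trace ℝ (TangentSpace (𝓡 n) x) (shapeOperator S.g ι η x)
              * S.inducedMetric (𝓡 n) ι x (magneticShapeOperator S.g S.form ι s x v η) v
          - S.inducedMetric (𝓡 n) ι x (magneticShapeOperator S.g S.form ι s x v η) (shapeOperator S.g ι η x v)
          - 1 / 4 * normOnPerp (S.inducedMetric (𝓡 n) ι) x v (thetaForm S.g S.form ι η x) ^ 2) := by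
  have hH : IsHypersurface S (𝓡 n) ι η :=
    ⟨hι, hι_inj, hη, hη_unit, hη_normal, by simp⟩
  -- The induced metric is by definition g(dι ·, dι ·), so `hv` serves as the unit condition in both
  -- N and M.
  exact ⟨fun x v w _ _ hvw => hH.magneticSec_eq s x v w hvw,
    fun x v hv => hH.magneticRic_eq s x v hv hv⟩
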